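/- Consider billiards in a regular pentagon $P$ (inscribed in the unit circle; the normalization is immaterial). A billiard trajectory moves along straight segments in $P$ and is reflected in the sides according to the law "angle of incidence = angle of reflection"; it is not allowed to hit a vertex. A trajectory is closed if its sequence of bounce points is periodic, and its length is the total length of its flights over the least positive even period of this sequence (so a trajectory that closes up after an odd number of reflections is traversed twice, like the closed trajectories parallel and close to it). Directions are taken in $\mathbb{RP}^1$, i.e. opposite directions are not distinguished; a direction is periodic if some closed billiard trajectory has a flight in this direction. For every periodic direction, the closed billiard trajectories having a flight in this direction have exactly two different lengths $\ell_{\mathrm{short}}<\ell_{\mathrm{long}}$, and $$\frac{\ell_{\mathrm{long}}}{\ell_{\mathrm{short}}}=\phi=\frac{1+\sqrt5}{2}.$$ -/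

import Mathlib

/-- The vertices of the regular pentagon inscribed in the unit circle, in cyclic order
(`pentagonVertex 5 = pentagonVertex 0`). -/
noncomputable def pentagonVertex (k : ℕ) : ℂ :=
  Complex.exp (2 * (Real.pi : ℂ) * Complex.I * (k : ℂ) / 5)

/-- The `k`-th side of the pentagon without its two endpoints. -/
noncomputable def pentagonSide (k : Fin 5) : Set ℂ :=
  openSegment ℝ (pentagonVertex k) (pentagonVertex ((k : ℕ) + 1))

/-- The linear reflection of a velocity vector `v` in the line through the origin parallel to
the `k`-th side: with `d` a vector along the side, `v ↦ (d / conj d) * conj v`. -/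
noncomputable def reflectInSide (k : Fin 5) (v : ℂ) : ℂ :=
  (pentagonVertex ((k : ℕ) + 1) - pentagonVertex k) /
      (starRingEnd ℂ) (pentagonVertex ((k : ℕ) + 1) - pentagonVertex k) *
    (starRingEnd ℂ) v

/-- The unit velocity on the flight from the `i`-th to the `(i+1)`-st bounce point. -/
noncomputable def flightDirection (q : ℕ → ℂ) (i : ℕ) : ℂ :=
  (q (i + 1) - q i) / (‖q (i + 1) - q i‖ : ℂ)

/-- `q` is the sequence of bounce points of a billiard trajectory in the regular pentagon that
never meets a vertex, and `s i` is the side containing `q i`. Successive bounces take place on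
different sides (the table is convex), and at each bounce the velocity is reflected in the side:
the angle of incidence equals the angle of reflection. -/
structure IsBilliardTrajectory (q : ℕ → ℂ) (s : ℕ → Fin 5) : Prop where
  mem_side : ∀ i, q i ∈ pentagonSide (s i)
  side_ne : ∀ i, s (i + 1) ≠ s i
  reflect : ∀ i, flightDirection q (i + 1) = reflectInSide (s (i + 1)) (flightDirection q i)

/-- `m` is the least positive even period of the bounce sequence `q`: a trajectory that closes up
after an odd number of bounces is traversed twice, as are its parallel neighbours. -/
def IsLeastEvenPeriod (q : ℕ → ℂ) (m : ℕ) : Prop :=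
  IsLeast {n : ℕ | 0 < n ∧ Even n ∧ Function.Periodic q n} m

/-- The lengths of the closed billiard trajectories in the regular pentagon having a flight
parallel to the vector `v` (directions are taken in the real projective line, so `v` and `-v`
give the same direction). -/
def closedTrajectoryLengths (v : ℂ) : Set ℝ :=
  {l : ℝ | ∃ (q : ℕ → ℂ) (s : ℕ → Fin 5) (m : ℕ),
    IsBilliardTrajectory q s ∧ (∃ r : ℝ, q 1 - q 0 = r • v) ∧ IsLeastEvenPeriod q m ∧
    l = ∑ i ∈ Finset.range m, ‖q (i + 1) - q i‖}

/-- A direction is periodic if some closed billiard trajectory has a flight in this direction. -/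
def IsPeriodicDirection (v : ℂ) : Prop :=
  (closedTrajectoryLengths v).Nonempty

/-! Reflecting a velocity in a side is minus a symmetry of the pentagon (`reflectInSide_eq`).
Folding back by that symmetry at every bounce therefore keeps the pentagon in place and reverses the
direction, so after two bounces the direction `u` returns and only a rotation by a multiple of 2π/5
has to be remembered. This is the flow on the double pentagon, of which the billiard surface is a
five-fold cover. Recording the transversal position of every second flight turns it into an exchange
of four intervals, with weights in the ring `ℝ × ZMod 5`: length up to a coboundary, and rotation.

Up to symmetry `u` lies in one sector (`exists_sector`). There the intervals have lengths `a, φa,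
φc, c` and weights `h₁, f h₁, f h₂, h₂` with `f = (φ, 3)`. Both components of `f` satisfy `f² = f +
1`: modulo 5 the number 3 plays the role of the golden ratio. This common relation is what makes the
argument work.

Inducing the exchange on a suitable subset gives an exchange of the same golden form with new `a, c,
h₁, h₂` (`goldenStep_twist`, `goldenStep_rotate`), the same cycle weights and shorter cycles. In a
periodic direction this must stop, and it stops only at `a = 0` or `c = 0`, where the exchange is
the identity on two intervals whose weights are `w₀` and `f w₀`. These are then all the weights of
primitive cycles in the original direction (`exists_cycleWeights_goldenStep_eq`).

A cycle of weight `w` closes up in the billiard after one turn if its rotation vanishes and after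
five turns otherwise. Multiplication by 3 preserves this alternative, so the lengths have the ratio
φ. -/

section WeightedSystems

/-! ### Weighted partial maps, their primitive cycles, and induced maps -/

variable {X X' V : Type*} [AddCommGroup V]

/-- `Hit S y n x w`: the walk of the weighted relation `S` that starts at `x` arrives at `y` for the
first time (after at least one step) after `n` steps, and the total weight of these steps is `w`. -/
inductive Hit (S : X → X → V → Prop) (y : X) : ℕ → X → V → Prop
  | last {x : X} {w : V} : S x y w → Hit S y 1 x w
  | cons {x z : X} {w w' : V} {n : ℕ} : S x z w → z ≠ y → Hit S y n z w' →
      Hit S y (n + 1) x (w + w')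

/-- The relation `S` is a partial weighted map. -/
def IsDet (S : X → X → V → Prop) : Prop :=
  ∀ ⦃x y y' w w'⦄, S x y w → S x y' w' → y = y' ∧ w = w'

/-- The point `x` returns to itself. -/
def IsCyclicPt (S : X → X → V → Prop) (x : X) : Prop := ∃ n w, Hit S x n x w

/-- The weights of the primitive cycles of `S`. -/
def cycleWeights (S : X → X → V → Prop) : Set V := {w | ∃ x n, Hit S x n x w}

/-- An `n`-step walk from `x` to `y` whose intermediate points avoid `J`. -/
inductive Excursion (S : X → X → V → Prop) (J : Set X) : ℕ → X → X → V → Prop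
  | one {x y : X} {w : V} : S x y w → Excursion S J 1 x y w
  | cons {x z y : X} {w w' : V} {n : ℕ} : S x z w → z ∉ J → Excursion S J n z y w' →
      Excursion S J (n + 1) x y (w + w')

variable {S : X → X → V → Prop} {S' : X' → X' → V → Prop}

theorem Hit.pos {x y : X} {n : ℕ} {w : V} (h : Hit S y n x w) : 0 < n := by
  cases h <;> omega

theorem Hit.exists_step {x y : X} {n : ℕ} {w : V} (h : Hit S y n x w) : ∃ z w', S x z w' := by
  cases h with
  | last h => exact ⟨_, _, h⟩
  | cons h _ _ => exact ⟨_, _, h⟩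

theorem Hit.unique (hS : IsDet S) {x y : X} {n n' : ℕ} {w w' : V} (h : Hit S y n x w)
    (h' : Hit S y n' x w') : n = n' ∧ w = w' := by
  induction h generalizing n' w' with
  | last h =>
    cases h' with
    | last h' => exact ⟨rfl, (hS h h').2⟩
    | cons h' hne _ => exact absurd (hS h h').1.symm hne
  | cons h hne _ ih =>
    cases h' with
    | last h' => exact absurd (hS h h').1 hne
    | cons h' _ h2 =>
      obtain ⟨rfl, rfl⟩ := hS h h'
      obtain ⟨rfl, rfl⟩ := ih h2
      exact ⟨rfl, rfl⟩

theorem Hit.exists_pred {x y : X} {n : ℕ} {w : V} (h : Hit S y n x w) : ∃ z w', S z y w' := by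
  induction h with
  | last h => exact ⟨_, _, h⟩
  | cons _ _ _ ih => exact ih

/-- The walk from `p` cannot meet `z` before `x`: by `Hit.unique` it would still need `m` steps from
there, but fewer are left. So the appended step `x → z` is the first arrival at `z`. -/
theorem Hit.rotate_aux (hS : IsDet S) {x z : X} {m : ℕ} {w₀ wz : V} (hxz : S x z w₀) (hne : z ≠ x)
    (hz : Hit S x m z wz) {p : X} {k : ℕ} {w : V} (h : Hit S x k p w) (hk : k ≤ m) :
    Hit S z (k + 1) p (w + w₀) := by
  induction h with
  | last h => exact .cons h hne.symm (.last hxz)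
  | @cons p p' w w' n h _ h' ih =>
    have hk' : n ≤ m := by omega
    rw [add_assoc w]
    refine .cons h ?_ (ih hk')
    rintro rfl
    have := (h'.unique hS hz).1
    omega

theorem Hit.rotate (hS : IsDet S) {x z : X} {n : ℕ} {w w₀ : V} (h : Hit S x n x w)
    (hxz : S x z w₀) : Hit S z n z w := by
  cases h with
  | last h =>
    obtain ⟨rfl, rfl⟩ := hS h hxz
    exact .last h
  | @cons _ _ w₁ _ _ h hne h' =>
    obtain ⟨rfl, rfl⟩ := hS h hxz
    rw [add_comm w₁]
    exact h'.rotate_aux hS hxz hne h' le_rfl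

theorem Hit.rotate_reachable (hS : IsDet S) {x z : X} {n : ℕ} {w : V} (h : Hit S x n x w)
    (hxz : Relation.ReflTransGen (fun p q => ∃ w, S p q w) x z) : Hit S z n z w := by
  induction hxz with
  | refl => exact h
  | tail _ h' ih => exact ih.rotate hS h'.choose_spec

/-- The tool against singular orbits: a cyclic point can be iterated forever, so it never lands on
an interval endpoint, where an exchange is undefined. -/
theorem IsCyclicPt.step (hS : IsDet S) {x : X} (h : IsCyclicPt S x) :
    ∃ z w, S x z w ∧ IsCyclicPt S z := by
  obtain ⟨n, w, h⟩ := h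
  obtain ⟨z, w', hz⟩ := h.exists_step
  exact ⟨z, w', hz, n, w, h.rotate hS hz⟩

theorem IsCyclicPt.pred {x : X} (h : IsCyclicPt S x) : ∃ z w, S z x w :=
  h.choose_spec.choose_spec.exists_pred

theorem Hit.map {e : X → X'} (he : Function.Injective e)
    (h : ∀ x y w, S x y w → S' (e x) (e y) w) {x y : X} {n : ℕ} {w : V} (hit : Hit S y n x w) :
    Hit S' (e y) n (e x) w := by
  induction hit with
  | last h' => exact .last (h _ _ _ h')
  | cons h' hne _ ih => exact .cons (h _ _ _ h') (he.ne hne) ih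

theorem Excursion.toHit {J : Set X} {x y : X} {n : ℕ} {w : V} (h : Excursion S J n x y w)
    (hy : y ∈ J) : Hit S y n x w := by
  induction h with
  | one h => exact .last h
  | cons h hz _ ih => exact .cons h (fun e => hz (e ▸ hy)) (ih hy)

theorem Excursion.append_hit {J : Set X} {x z t : X} {n m : ℕ} {w w' : V}
    (h : Excursion S J n x z w) (ht : t ∈ J) (hz : z ≠ t) (h' : Hit S t m z w') :
    Hit S t (n + m) x (w + w') := by
  induction h with
  | one h => rw [add_comm 1]; exact .cons h hz h'
  | @cons x p y w w₁ n h hp _ ih =>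
    rw [add_assoc w, add_right_comm n]
    exact .cons h (fun e => hp (e ▸ ht)) (ih hz h')

/-- A walk to `y ∈ J` starts with any given excursion away from `J`. -/
theorem Excursion.hit_cases (hS : IsDet S) {J : Set X} {x z y : X} {k n : ℕ} {w w' : V}
    (h : Excursion S J k x z w) (hy : y ∈ J) (h' : Hit S y n x w') :
    z = y ∨ ∃ m w₂, m < n ∧ Hit S y m z w₂ := by
  induction h generalizing n w' with
  | one h =>
    cases h' with
    | last h' => exact .inl (hS h h').1
    | @cons _ p _ w₂ m h₁ _ h₂ =>
      obtain ⟨rfl, -⟩ := hS h h₁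
      exact .inr ⟨_, _, Nat.lt_succ_self _, h₂⟩
  | cons h hz _ ih =>
    cases h' with
    | last h' => exact absurd ((hS h h').1 ▸ hy) hz
    | cons h₁ _ h₂ =>
      obtain ⟨rfl, -⟩ := hS h h₁
      rcases ih h₂ with h | ⟨m, w₂, hm, h⟩
      · exact .inl h
      · exact .inr ⟨m, w₂, by omega, h⟩

theorem Excursion.reachable {J : Set X} {x y : X} {n : ℕ} {w : V} (h : Excursion S J n x y w) :
    Relation.ReflTransGen (fun p q => ∃ w, S p q w) x y := by
  induction h with
  | one h => exact .single ⟨_, h⟩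
  | cons h _ _ ih => exact .head ⟨_, h⟩ ih

/-- `S'` is, up to the embedding `emb` and the coboundary of `pot`, the map induced by `S` on `J`.
The function `height` forces strictly more steps in `S` than in `S'` along a cycle. -/
structure IsInduced (S : X → X → V → Prop) (S' : X' → X' → V → Prop) (D : Set X') (J : Set X)
    (emb : X' → X) (pot : X' → V) (height : X' → ℝ) (K : ℝ) : Prop where
  det : IsDet S
  mem : ∀ {x y w}, S' x y w → x ∈ D
  mapsTo : ∀ {x}, x ∈ D → emb x ∈ J
  injOn : ∀ {x y}, x ∈ D → y ∈ D → emb x = emb y → x = y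
  excursion : ∀ {x y w}, S' x y w → y ∈ D → ∃ n : ℕ, Excursion S J n (emb x) (emb y) (w + pot y - pot x) ∧
    0 < ((n : ℝ) - 1) * K + height y - height x
  exists_step : ∀ {x}, x ∈ D → IsCyclicPt S (emb x) → ∃ y ∈ D, ∃ w, S' x y w
  reaches : ∀ {x}, IsCyclicPt S x →
    ∃ z ∈ D, Relation.ReflTransGen (fun p q => ∃ w, S p q w) x (emb z)

namespace IsInduced

variable {D : Set X'} {J : Set X} {emb : X' → X} {pot : X' → V} {height : X' → ℝ} {K : ℝ}

theorem hit (h : IsInduced S S' D J emb pot height K) {t x : X'} {n' : ℕ} {w : V} (ht : t ∈ D)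
    (h' : Hit S' t n' x w) : ∃ n : ℕ, Hit S (emb t) n (emb x) (w + pot t - pot x) ∧
      0 < ((n : ℝ) - n') * K + height t - height x := by
  induction h' with
  | last h' =>
    obtain ⟨n, hn, hK⟩ := h.excursion h' ht
    exact ⟨n, hn.toHit (h.mapsTo ht), by simpa using hK⟩
  | @cons x z w w' m h' hne hh ih =>
    have hz : z ∈ D := h.mem hh.exists_step.choose_spec.choose_spec
    obtain ⟨n, hn, hK⟩ := h.excursion h' hz
    obtain ⟨n₂, hn₂, hK₂⟩ := ih
    refine ⟨n + n₂, ?_, ?_⟩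
    · have := hn.append_hit (h.mapsTo ht)
        (fun e => hne (h.injOn hz ht e)) hn₂
      convert this using 1
      abel
    · push_cast
      linarith

/-- Each step of `S'` uses up at least one of the `n` steps of `S` left before `emb t`, and cannot
jump over `emb t ∈ J`. -/
theorem exists_hit (h : IsInduced S S' D J emb pot height K) {t : X'} (ht : t ∈ D) (n : ℕ) :
    ∀ {x : X'} {w : V}, x ∈ D → IsCyclicPt S (emb x) → Hit S (emb t) n (emb x) w →
      ∃ n' w', Hit S' t n' x w' := by
  induction n using Nat.strong_induction_on with
  | _ n ih =>
    intro x w hx hc hh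
    obtain ⟨y, hyD, w', hy⟩ := h.exists_step hx hc
    obtain ⟨k, hk, -⟩ := h.excursion hy hyD
    by_cases hyt : y = t
    · exact ⟨1, w', .last (hyt ▸ hy)⟩
    · rcases hk.hit_cases h.det (h.mapsTo ht) hh with he | ⟨m, w₂, hm, h₂⟩
      · exact absurd (h.injOn hyD ht he) hyt
      · obtain ⟨n₁, w₁, h₁⟩ := hc
        obtain ⟨n', w', h'⟩ := ih m hm hyD ⟨n₁, w₁, h₁.rotate_reachable h.det hk.reachable⟩ h₂
        exact ⟨_, _, .cons hy hyt h'⟩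

/-- Around a cycle both `pot` and `height` telescope to zero: the weight is unchanged, and the
inequality becomes `0 < (n - n') * K`. This is the descent behind the renormalization. -/
theorem exists_cycle (h : IsInduced S S' D J emb pot height K) (hK : 0 < K) {x : X} {n : ℕ} {w : V}
    (hx : Hit S x n x w) : ∃ x' n', n' < n ∧ Hit S' x' n' x' w := by
  obtain ⟨z, hz, hr⟩ := h.reaches ⟨n, w, hx⟩
  have hc := hx.rotate_reachable h.det hr
  obtain ⟨n', w', h'⟩ := h.exists_hit hz n hz ⟨n, w, hc⟩ hc
  obtain ⟨m, hm, hlt⟩ := h.hit hz h'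
  obtain ⟨rfl, rfl⟩ := hc.unique h.det hm
  refine ⟨z, n', ?_, by simpa using h'⟩
  have : 0 < ((n : ℝ) - n') * K := by linarith
  have := (pos_iff_pos_of_mul_pos this).2 hK
  exact_mod_cast sub_pos.1 this

theorem cycleWeights_eq (h : IsInduced S S' D J emb pot height K) (hK : 0 < K) :
    cycleWeights S = cycleWeights S' := by
  ext w
  constructor
  · rintro ⟨x, n, hx⟩
    obtain ⟨x', n', -, h'⟩ := h.exists_cycle hK hx
    exact ⟨x', n', h'⟩
  · rintro ⟨x, n, hx⟩
    obtain ⟨z, w', hz⟩ := hx.exists_step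
    obtain ⟨m, hm, -⟩ := h.hit (h.mem hz) hx
    exact ⟨_, m, by simpa using hm⟩

end IsInduced

end WeightedSystems

/-! ### Renormalization of golden interval exchanges -/

section GoldenExchange

variable {V : Type*} [CommRing V]

/-- The exchange of four intervals of lengths `a, A, C, c` with golden weights. -/
def GoldenStep (a A C c : ℝ) (f h₁ h₂ : V) (x y : ℝ) (w : V) : Prop :=
  (0 < x ∧ x < a ∧ y = x + C ∧ w = h₁) ∨
  (a < x ∧ x < a + A ∧ y = x + C + c ∧ w = f * h₁) ∨
  (a + A < x ∧ x < a + A + C ∧ y = x - a - A ∧ w = f * h₂) ∨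
  (a + A + C < x ∧ x < a + A + C + c ∧ y = x - A ∧ w = h₂)

variable {a A C c : ℝ} {f h₁ h₂ : V}

theorem GoldenStep.isDet (hA : 0 ≤ A) (hC : 0 ≤ C) :
    IsDet (GoldenStep a A C c f h₁ h₂) := by
  intro x y y' w w' hl hr
  rcases hl with ⟨h, h', rfl, rfl⟩ | ⟨h, h', rfl, rfl⟩ | ⟨h, h', rfl, rfl⟩ | ⟨h, h', rfl, rfl⟩ <;>
  rcases hr with ⟨k, k', rfl, rfl⟩ | ⟨k, k', rfl, rfl⟩ | ⟨k, k', rfl, rfl⟩ | ⟨k, k', rfl, rfl⟩ <;>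
  first
  | exact ⟨rfl, rfl⟩
  | (exfalso; linarith)

/-- The intervals `a, A, C, c` are rearranged to `C, a, c, A`. Reversing both orders gives the same
pattern for `c, C, A, a`. -/
theorem GoldenStep.swap {x y : ℝ} {w : V} (h : GoldenStep a A C c f h₁ h₂ x y w) :
    GoldenStep c C A a f h₂ h₁ (a + A + C + c - x) (a + A + C + c - y) w := by
  unfold GoldenStep
  rcases h with ⟨h, h', rfl, rfl⟩ | ⟨h, h', rfl, rfl⟩ | ⟨h, h', rfl, rfl⟩ | ⟨h, h', rfl, rfl⟩
  · right; right; right; refine ⟨?_, ?_, ?_, rfl⟩ <;> linarith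
  · right; right; left; refine ⟨?_, ?_, ?_, rfl⟩ <;> linarith
  · right; left; refine ⟨?_, ?_, ?_, rfl⟩ <;> linarith
  · left; refine ⟨?_, ?_, ?_, rfl⟩ <;> linarith

theorem hit_goldenStep_swap {x y : ℝ} {w : V} {n : ℕ}
    (h : Hit (GoldenStep a A C c f h₁ h₂) y n x w) :
    Hit (GoldenStep c C A a f h₂ h₁) (a + A + C + c - y) n (a + A + C + c - x) w :=
  h.map (e := fun x => a + A + C + c - x) (fun _ _ h => by simpa using h) fun _ _ _ h => h.swap

theorem cycleWeights_goldenStep_swap :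
    cycleWeights (GoldenStep a A C c f h₁ h₂) = cycleWeights (GoldenStep c C A a f h₂ h₁) := by
  ext w
  constructor
  · rintro ⟨x, n, h⟩
    exact ⟨_, n, hit_goldenStep_swap h⟩
  · rintro ⟨x, n, h⟩
    exact ⟨_, n, hit_goldenStep_swap h⟩

theorem GoldenStep.mem_Ioo {x y : ℝ} {w : V} (ha : 0 ≤ a) (hA : 0 ≤ A) (hC : 0 ≤ C) (hc : 0 ≤ c)
    (h : GoldenStep a A C c f h₁ h₂ x y w) :
    x ∈ Set.Ioo 0 (a + A + C + c) ∧ y ∈ Set.Ioo 0 (a + A + C + c) := by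
  simp only [Set.mem_Ioo]
  rcases h with ⟨h, h', rfl, rfl⟩ | ⟨h, h', rfl, rfl⟩ | ⟨h, h', rfl, rfl⟩ | ⟨h, h', rfl, rfl⟩ <;>
  refine ⟨⟨?_, ?_⟩, ?_, ?_⟩ <;> linarith

theorem goldenStep_one {z : ℝ} (hz : 0 < z) (hz' : z < a) :
    GoldenStep a A C c f h₁ h₂ z (z + C) h₁ := .inl ⟨hz, hz', rfl, rfl⟩

theorem goldenStep_two {z : ℝ} (hz : a < z) (hz' : z < a + A) :
    GoldenStep a A C c f h₁ h₂ z (z + C + c) (f * h₁) := .inr <| .inl ⟨hz, hz', rfl, rfl⟩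

theorem goldenStep_three {z : ℝ} (hz : a + A < z) (hz' : z < a + A + C) :
    GoldenStep a A C c f h₁ h₂ z (z - a - A) (f * h₂) := .inr <| .inr <| .inl ⟨hz, hz', rfl, rfl⟩

theorem goldenStep_four {z : ℝ} (hz : a + A + C < z) (hz' : z < a + A + C + c) :
    GoldenStep a A C c f h₁ h₂ z (z - A) h₂ := .inr <| .inr <| .inr ⟨hz, hz', rfl, rfl⟩

theorem Excursion.of_eq {X V : Type*} [AddCommGroup V] {S : X → X → V → Prop} {J : Set X} {n : ℕ}
    {x y y' : X} {w w' : V} (h : Excursion S J n x y w) (hy : y = y') (hw : w = w') :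
    Excursion S J n x y' w' := hy ▸ hw ▸ h

/-- When the direction is nearly parallel to a cylinder, undo a Dehn twist. -/
theorem goldenStep_twist (hf : f * f = f + 1) (hC : 0 < C) (hc : 0 < c) (ha : C ≤ a)
    (hA : C + c ≤ A) :
    IsInduced (GoldenStep a A C c f h₁ h₂)
      (GoldenStep (a - C) (A - C - c) C c f h₁ (h₂ + f * h₁))
      (Set.Ioo 0 (a + A - C) \ {a - C})
      {x | (C < x ∧ x < a) ∨ (a + C + c < x ∧ x < a + A + C + c)}
      (fun x => if x < a - C then x + C else x + 2 * C + c)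
      (fun x => if x < a - C then 0 else f * h₁) id (a + A + C + c) where
  det := GoldenStep.isDet (by linarith) hC.le
  mem {x y w} h := by
    simp only [Set.mem_sdiff, Set.mem_Ioo, Set.mem_singleton_iff]
    rcases h with ⟨h, h', -⟩ | ⟨h, h', -⟩ | ⟨h, h', -⟩ | ⟨h, h', -⟩ <;>
    refine ⟨⟨?_, ?_⟩, fun e => ?_⟩ <;> linarith
  mapsTo {x} h := by
    obtain ⟨⟨h, h'⟩, hne⟩ := h
    simp only [Set.mem_ofPred_eq]
    split_ifs with hx
    · left; constructor <;> linarith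
    · have : a - C < x := lt_of_le_of_ne (not_lt.1 hx) fun e => hne e.symm
      right; constructor <;> linarith
  injOn {x y} _ _ h := by
    split_ifs at h <;> linarith
  excursion {x y w} h hy := by
    set J : Set ℝ := {x | (C < x ∧ x < a) ∨ (a + C + c < x ∧ x < a + A + C + c)} with hJ
    obtain ⟨⟨hy₀, hy₁⟩, hne⟩ := hy
    have hne' : y ≠ a - C := hne
    have hnot₁ : ∀ z, z < C → z ∉ J := by
      rintro z hz (h | h) <;> linarith
    have hnot₂ : ∀ z, a < z → z < a + C + c → z ∉ J := by
      rintro z hz hz' (h | h) <;> linarith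
    -- One-step excursions move to the right; longer ones contribute at least `K`, which exceeds
    -- every displacement. Hence `height = id` works.
    simp only [id]
    -- The new third weight `f * (h₂ + f * h₁)` equals `f * h₂ + h₁ + f * h₁` by `hf`: a passage
    -- through intervals three, one and two. The potential pays for the last visit to interval two,
    -- which is missing if the excursion ends in the lower part of `J`.
    rcases h with ⟨h, h', e, rfl⟩ | ⟨h, h', e, rfl⟩ | ⟨h, h', e, rfl⟩ | ⟨h, h', e, rfl⟩
    · rw [if_pos h', if_pos h']
      rcases lt_or_gt_of_ne hne' with hlt | hgt
      · rw [if_pos hlt, if_pos hlt]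
        refine ⟨1, (Excursion.one (goldenStep_one (z := x + C) (by linarith) (by linarith))).of_eq
          (by linarith) (by ring), by push_cast; linarith⟩
      · rw [if_neg hgt.not_gt, if_neg hgt.not_gt]
        refine ⟨2, (Excursion.cons (goldenStep_one (z := x + C) (by linarith) (by linarith))
          (hnot₂ _ (by linarith) (by linarith))
          (.one (goldenStep_two (by linarith) (by linarith)))).of_eq
          (by linarith) (by ring), by push_cast; linarith⟩
    · rw [if_neg (by linarith), if_neg (by linarith), if_neg (by linarith), if_neg (by linarith)]
      refine ⟨1, (Excursion.one (goldenStep_two (z := x + 2 * C + c) (by linarith)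
        (by linarith))).of_eq (by linarith) (by ring), by push_cast; linarith⟩
    · rw [if_neg (by linarith : ¬ x < a - C), if_neg (by linarith : ¬ x < a - C)]
      rcases lt_or_gt_of_ne hne' with hlt | hgt
      · rw [if_pos hlt, if_pos hlt]
        refine ⟨2, (Excursion.cons (goldenStep_three (z := x + 2 * C + c) (by linarith)
          (by linarith)) (hnot₁ _ (by linarith))
          (.one (goldenStep_one (by linarith) (by linarith)))).of_eq
          (by linarith) (by linear_combination (-h₁) * hf), by push_cast; linarith⟩
      · rw [if_neg hgt.not_gt, if_neg hgt.not_gt]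
        refine ⟨3, (Excursion.cons (goldenStep_three (z := x + 2 * C + c) (by linarith)
          (by linarith)) (hnot₁ _ (by linarith))
          (.cons (goldenStep_one (by linarith) (by linarith))
            (hnot₂ _ (by linarith) (by linarith))
            (.one (goldenStep_two (by linarith) (by linarith))))).of_eq
          (by linarith) (by linear_combination (-h₁) * hf), by push_cast; linarith⟩
    · rw [if_neg (by linarith), if_neg (by linarith), if_neg (by linarith), if_neg (by linarith)]
      refine ⟨2, (Excursion.cons (goldenStep_four (z := x + 2 * C + c) (by linarith)
        (by linarith)) (hnot₂ _ (by linarith) (by linarith))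
        (.one (goldenStep_two (by linarith) (by linarith)))).of_eq
        (by linarith) (by ring), by push_cast; linarith⟩
  exists_step {x} hx h := by
    have hdet : IsDet (GoldenStep a A C c f h₁ h₂) := GoldenStep.isDet (by linarith) hC.le
    obtain ⟨⟨hx₀, hx₁⟩, hne⟩ := hx
    simp only [Set.mem_sdiff, Set.mem_Ioo, Set.mem_singleton_iff]
    split_ifs at h with hlt
    · refine ⟨_, ⟨⟨?_, ?_⟩, fun e => ?_⟩, _, goldenStep_one hx₀ hlt⟩
      · linarith
      · linarith
      -- If the image were the removed point `a - C`, the orbit would run into the endpoint `a`.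
      · obtain ⟨z, w, hz, hc⟩ := h.step hdet
        obtain ⟨rfl, -⟩ := hdet hz (goldenStep_one (by linarith) (by linarith))
        obtain ⟨z, w, hz, -⟩ := hc.step hdet
        rcases hz with ⟨_, _, -⟩ | ⟨_, _, -⟩ | ⟨_, _, -⟩ | ⟨_, _, -⟩ <;> linarith
    · have hgt : a - C < x := lt_of_le_of_ne (not_lt.1 hlt) fun e => hne e.symm
      obtain ⟨z, w, hz, hc⟩ := h.step hdet
      rcases hz with ⟨k, k', e, rfl⟩ | ⟨k, k', e, rfl⟩ | ⟨k, k', e, rfl⟩ | ⟨k, k', e, rfl⟩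
      · exfalso; linarith
      · refine ⟨_, ⟨⟨?_, ?_⟩, fun e => ?_⟩, _, goldenStep_two hgt (by linarith)⟩ <;> linarith
      · refine ⟨_, ⟨⟨?_, ?_⟩, fun e => ?_⟩, _, goldenStep_three (by linarith) (by linarith)⟩
        · linarith
        · linarith
        · obtain ⟨z', w, hz, hc⟩ := hc.step hdet
          obtain ⟨rfl, -⟩ := hdet hz (goldenStep_one (by linarith) (by linarith))
          obtain ⟨z, w, hz, -⟩ := hc.step hdet
          rcases hz with ⟨_, _, -⟩ | ⟨_, _, -⟩ | ⟨_, _, -⟩ | ⟨_, _, -⟩ <;> linarith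
      · refine ⟨_, ⟨⟨?_, ?_⟩, fun e => ?_⟩, _, goldenStep_four (by linarith) (by linarith)⟩ <;>
        linarith
  reaches {x} h := by
    have hdet : IsDet (GoldenStep a A C c f h₁ h₂) := GoldenStep.isDet (by linarith) hC.le
    have hlow : ∀ z, C < z → z < a → z - C ∈ Set.Ioo 0 (a + A - C) \ {a - C} ∧
        (if z - C < a - C then z - C + C else z - C + 2 * C + c) = z := by
      intro z hz hz'
      rw [if_pos (by linarith)]
      exact ⟨⟨⟨by linarith, by linarith⟩, fun e => hz'.ne (by simpa using e)⟩, by ring⟩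
    have hhigh : ∀ z, a + C + c < z → z < a + A + C + c →
        z - 2 * C - c ∈ Set.Ioo 0 (a + A - C) \ {a - C} ∧
        (if z - 2 * C - c < a - C then z - 2 * C - c + C else z - 2 * C - c + 2 * C + c) = z := by
      intro z hz hz'
      rw [if_neg (by linarith)]
      refine ⟨⟨⟨by linarith, by linarith⟩, fun e => ?_⟩, by ring⟩
      have : z - 2 * C - c = a - C := e
      linarith
    have htwo : ∀ z, a < z → z < a + C + c → ∃ t ∈ Set.Ioo 0 (a + A - C) \ {a - C},
        Relation.ReflTransGen (fun p q => ∃ w, GoldenStep a A C c f h₁ h₂ p q w) z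
          (if t < a - C then t + C else t + 2 * C + c) := by
      intro z hz hz'
      obtain ⟨h1, h2⟩ := hhigh (z + C + c) (by linarith) (by linarith)
      exact ⟨_, h1, by rw [h2]; exact .single ⟨_, goldenStep_two hz (by linarith)⟩⟩
    obtain ⟨z, w, hz, hc⟩ := h.step hdet
    obtain ⟨p, wp, hp⟩ := h.pred
    -- The points `C` and `a + C + c` separate images of intervals, so they have no predecessor.
    by_cases hxC : x = C
    · exfalso
      rcases hp with ⟨_, _, _, -⟩ | ⟨_, _, _, -⟩ | ⟨_, _, _, -⟩ | ⟨_, _, _, -⟩ <;> linarith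
    by_cases hxa : x = a + C + c
    · exfalso
      rcases hp with ⟨_, _, _, -⟩ | ⟨_, _, _, -⟩ | ⟨_, _, _, -⟩ | ⟨_, _, _, -⟩ <;> linarith
    have hx₀ : 0 < x ∧ x < a + A + C + c ∧ x ≠ a := by
      rcases hz with ⟨_, _, -⟩ | ⟨_, _, -⟩ | ⟨_, _, -⟩ | ⟨_, _, -⟩ <;>
      refine ⟨?_, ?_, fun e => ?_⟩ <;> linarith
    rcases lt_or_gt_of_ne hxa with h₁' | h₁'
    · rcases lt_or_gt_of_ne hx₀.2.2 with h₂' | h₂'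
      · rcases lt_or_gt_of_ne hxC with h₃' | h₃'
        · obtain ⟨rfl, -⟩ := hdet hz (goldenStep_one hx₀.1 h₂')
          have hstep : ∃ w, GoldenStep a A C c f h₁ h₂ x (x + C) w := ⟨_, hz⟩
          obtain ⟨y, w', hy, -⟩ := hc.step hdet
          have hne : x + C ≠ a := by
            rcases hy with ⟨_, _, -⟩ | ⟨_, _, -⟩ | ⟨_, _, -⟩ | ⟨_, _, -⟩ <;>
            intro e <;> linarith
          rcases lt_or_gt_of_ne hne with h₄' | h₄'
          · obtain ⟨h1, h2⟩ := hlow (x + C) (by linarith) h₄'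
            exact ⟨_, h1, by rw [h2]; exact .single hstep⟩
          · obtain ⟨t, ht, hr⟩ := htwo (x + C) h₄' (by linarith)
            exact ⟨t, ht, .head hstep hr⟩
        · obtain ⟨h1, h2⟩ := hlow x h₃' h₂'
          exact ⟨_, h1, by rw [h2]⟩
      · exact htwo x h₂' h₁'
    · obtain ⟨h1, h2⟩ := hhigh x h₁' hx₀.2.1
      exact ⟨_, h1, by rw [h2]⟩

/-- The remaining case of the renormalization, where the twist is followed by a rotation. -/
theorem goldenStep_rotate (hf : f * f = f + 1) (hc : 0 < c) (hac : c ≤ a)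
    (ha : a < C) (hCA : C ≤ A) (hA : A < C + c) :
    IsInduced (GoldenStep a A C c f h₁ h₂)
      (GoldenStep (A - C) (A + a - C - c) (C + c - A) (C - a) f (f * h₁ + h₂) (f * h₁ + f * h₂))
      (Set.Ioo 0 A) (Set.Ioo (a + C) (a + A + C)) (fun x => x + a + C) 0 0 1 where
  det := GoldenStep.isDet (by linarith) (by linarith)
  mem {x y w} h := by
    rcases h with ⟨h, h', -⟩ | ⟨h, h', -⟩ | ⟨h, h', -⟩ | ⟨h, h', -⟩ <;>
    constructor <;> linarith
  mapsTo {x} h := by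
    obtain ⟨h, h'⟩ := h
    constructor <;> linarith
  injOn {x y} _ _ h := by linarith
  excursion {x y w} h _ := by
    have hnot₁ : ∀ z, z < a + C → z ∉ Set.Ioo (a + C) (a + A + C) :=
      fun z hz h => by linarith [h.1]
    have hnot₂ : ∀ z, a + A + C < z → z ∉ Set.Ioo (a + C) (a + A + C) :=
      fun z hz h => by linarith [h.2]
    simp only [Pi.zero_apply]
    -- The itineraries through the old intervals are 2-4, 3-1-2, 3-1-2-4 and 3-2; `hf` makes the two
    -- middle weights golden multiples of the outer ones. All have at least two steps, so `height =
    -- 0` suffices.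
    rcases h with ⟨h, h', e, rfl⟩ | ⟨h, h', e, rfl⟩ | ⟨h, h', e, rfl⟩ | ⟨h, h', e, rfl⟩
    · exact ⟨2, (Excursion.cons (goldenStep_two (z := x + a + C) (by linarith) (by linarith))
        (hnot₂ _ (by linarith)) (.one (goldenStep_four (by linarith) (by linarith)))).of_eq
        (by linarith) (by ring), by norm_num⟩
    · exact ⟨3, (Excursion.cons (goldenStep_three (z := x + a + C) (by linarith) (by linarith))
        (hnot₁ _ (by linarith)) (.cons (goldenStep_one (by linarith) (by linarith))
        (hnot₁ _ (by linarith)) (.one (goldenStep_two (by linarith) (by linarith))))).of_eq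
        (by linarith) (by linear_combination (-h₁) * hf), by norm_num⟩
    · exact ⟨4, (Excursion.cons (goldenStep_three (z := x + a + C) (by linarith) (by linarith))
        (hnot₁ _ (by linarith)) (.cons (goldenStep_one (by linarith) (by linarith))
        (hnot₁ _ (by linarith)) (.cons (goldenStep_two (by linarith) (by linarith))
        (hnot₂ _ (by linarith)) (.one (goldenStep_four (by linarith) (by linarith)))))).of_eq
        (by linarith) (by linear_combination (-h₁ - h₂) * hf), by norm_num⟩
    · exact ⟨2, (Excursion.cons (goldenStep_three (z := x + a + C) (by linarith) (by linarith))
        (hnot₁ _ (by linarith)) (.one (goldenStep_two (by linarith) (by linarith)))).of_eq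
        (by linarith) (by ring), by norm_num⟩
  exists_step {x} hx h := by
    have hdet : IsDet (GoldenStep a A C c f h₁ h₂) := GoldenStep.isDet (by linarith) (by linarith)
    obtain ⟨hx₀, hx₁⟩ := hx
    obtain ⟨z, w, hz, hc⟩ := h.step hdet
    rcases hz with ⟨k, k', e, rfl⟩ | ⟨k, k', e, rfl⟩ | ⟨k, k', e, rfl⟩ | ⟨k, k', e, rfl⟩
    · exfalso; linarith
    · exact ⟨_, ⟨by linarith, by linarith⟩, _, goldenStep_one hx₀ (by linarith)⟩
    · obtain ⟨z₂, w, hz, hc⟩ := hc.step hdet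
      rcases hz with ⟨l, l', e', rfl⟩ | ⟨l, l', e', rfl⟩ | ⟨l, l', e', rfl⟩ | ⟨l, l', e', rfl⟩
      · obtain ⟨z₃, w, hz, hc⟩ := hc.step hdet
        obtain ⟨rfl, -⟩ := hdet hz (goldenStep_two (by linarith) (by linarith))
        obtain ⟨z₄, w, hz, hc⟩ := hc.step hdet
        have hne : x ≠ A - C + (A + a - C - c) := by
          rcases hz with ⟨_, _, -⟩ | ⟨_, _, -⟩ | ⟨_, _, -⟩ | ⟨_, _, -⟩ <;>
          intro e <;> linarith
        rcases lt_or_gt_of_ne hne with h' | h'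
        · exact ⟨_, ⟨by linarith, by linarith⟩, _, goldenStep_two (by linarith) h'⟩
        · exact ⟨_, ⟨by linarith, by linarith⟩, _, goldenStep_three h' (by linarith)⟩
      · exact ⟨_, ⟨by linarith, by linarith⟩, _, goldenStep_four (by linarith) (by linarith)⟩
      · exfalso; linarith
      · exfalso; linarith
    · exfalso; linarith
  reaches {x} h := by
    have hdet : IsDet (GoldenStep a A C c f h₁ h₂) := GoldenStep.isDet (by linarith) (by linarith)
    have hmid : ∀ z, a + C < z → z < a + A + C → ∃ t ∈ Set.Ioo 0 A,
        Relation.ReflTransGen (fun p q => ∃ w, GoldenStep a A C c f h₁ h₂ p q w) z (t + a + C) :=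
      fun z hz hz' => ⟨z - a - C, ⟨by linarith, by linarith⟩,
        by rw [show z - a - C + a + C = z by ring]⟩
    have hfour : ∀ z, a + A + C < z → z < a + A + C + c → ∃ t ∈ Set.Ioo 0 A,
        Relation.ReflTransGen (fun p q => ∃ w, GoldenStep a A C c f h₁ h₂ p q w) z
          (t + a + C) := by
      intro z hz hz'
      obtain ⟨t, ht, hr⟩ := hmid (z - A) (by linarith) (by linarith)
      exact ⟨t, ht, .head ⟨_, goldenStep_four hz hz'⟩ hr⟩
    have htwo : ∀ z, IsCyclicPt (GoldenStep a A C c f h₁ h₂) z → a < z → z < a + A →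
        ∃ t ∈ Set.Ioo 0 A, Relation.ReflTransGen
          (fun p q => ∃ w, GoldenStep a A C c f h₁ h₂ p q w) z (t + a + C) := by
      intro z hcyc hz hz'
      obtain ⟨z₂, w, hz₂, hc⟩ := hcyc.step hdet
      obtain ⟨rfl, -⟩ := hdet hz₂ (goldenStep_two hz hz')
      obtain ⟨z₃, w₃, hz₃, -⟩ := hc.step hdet
      have hne : z + C + c ≠ a + A + C := by
        rcases hz₃ with ⟨_, _, -⟩ | ⟨_, _, -⟩ | ⟨_, _, -⟩ | ⟨_, _, -⟩ <;>
        intro e <;> linarith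
      rcases lt_or_gt_of_ne hne with h' | h'
      · obtain ⟨t, ht, hr⟩ := hmid (z + C + c) (by linarith) h'
        exact ⟨t, ht, .head ⟨_, hz₂⟩ hr⟩
      · obtain ⟨t, ht, hr⟩ := hfour (z + C + c) h' (by linarith)
        exact ⟨t, ht, .head ⟨_, hz₂⟩ hr⟩
    obtain ⟨z, w, hz, hc⟩ := h.step hdet
    rcases hz with ⟨k, k', e, rfl⟩ | ⟨k, k', e, rfl⟩ | ⟨k, k', e, rfl⟩ | ⟨k, k', e, rfl⟩
    · subst e
      obtain ⟨t, ht, hr⟩ := htwo _ hc (by linarith) (by linarith)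
      exact ⟨t, ht, .head ⟨_, goldenStep_one k k'⟩ hr⟩
    · exact htwo x h k k'
    · exact hmid x (by linarith) (by linarith)
    · exact hfour x k k'

/-- Both remaining translations are zero, so every point inside an interval is fixed: the intervals
are the cross-sections of two cylinders. -/
theorem cycleWeights_goldenStep_degenerate (hC : 0 < C) (hc : 0 < c) :
    cycleWeights (GoldenStep 0 0 C c f h₁ h₂) = {h₂, f * h₂} := by
  have key : ∀ x y w, GoldenStep 0 0 C c f h₁ h₂ x y w → y = x ∧ (w = h₂ ∨ w = f * h₂) := by
    intro x y w h
    rcases h with ⟨_, _, -⟩ | ⟨_, _, -⟩ | ⟨_, _, rfl, rfl⟩ | ⟨_, _, rfl, rfl⟩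
    · exfalso; linarith
    · exfalso; linarith
    · exact ⟨by ring, .inr rfl⟩
    · exact ⟨by ring, .inl rfl⟩
  ext w
  constructor
  · rintro ⟨x, n, h⟩
    cases h with
    | last h => exact (key _ _ _ h).2
    | cons h hne _ => exact absurd (key _ _ _ h).1 hne
  · rintro (rfl | rfl)
    · refine ⟨C + c / 2, 1, .last ?_⟩
      have := goldenStep_four (a := 0) (A := 0) (C := C) (c := c) (f := f) (h₁ := h₁) (h₂ := w)
        (z := C + c / 2) (by linarith) (by linarith)
      simpa using this
    · refine ⟨C / 2, 1, .last ?_⟩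
      have := goldenStep_three (a := 0) (A := 0) (C := C) (c := c) (f := f) (h₁ := h₁) (h₂ := h₂)
        (z := C / 2) (by linarith) (by linarith)
      simpa using this

open Real in
/-- If a golden exchange has a cycle, then its primitive cycles have exactly two weights, and
these differ by the factor `f`. -/
theorem exists_cycleWeights_goldenStep_eq (hf : f * f = f + 1) (n : ℕ) :
    ∀ (a c : ℝ) (h₁ h₂ : V) (x : ℝ) (w : V), 0 ≤ a → 0 ≤ c → 0 < a + c →
      Hit (GoldenStep a (goldenRatio * a) (goldenRatio * c) c f h₁ h₂) x n x w →
      ∃ w₀, cycleWeights (GoldenStep a (goldenRatio * a) (goldenRatio * c) c f h₁ h₂) =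
        {w₀, f * w₀} := by
  have hg := one_lt_goldenRatio
  have hg₂ := goldenRatio_lt_two
  have hsq := goldenRatio_sq
  -- The induction is on the length of a given cycle, which each renormalization shortens; without a
  -- cycle nothing would force it to stop.
  induction n using Nat.strong_induction_on with
  | _ n ih =>
    have main : ∀ (a c : ℝ) (h₁ h₂ : V) (x : ℝ) (w : V), 0 ≤ a → 0 < c → c ≤ a →
        Hit (GoldenStep a (goldenRatio * a) (goldenRatio * c) c f h₁ h₂) x n x w →
        ∃ w₀, cycleWeights (GoldenStep a (goldenRatio * a) (goldenRatio * c) c f h₁ h₂) =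
          {w₀, f * w₀} := by
      intro a c h₁ h₂ x w ha hc hac hit
      have hC : 0 < goldenRatio * c := by positivity
      have hsqc : goldenRatio * (goldenRatio * c) = goldenRatio * c + c := by
        linear_combination c * hsq
      rcases le_or_gt (goldenRatio * c) a with h | h
      · have hA : goldenRatio * c + c ≤ goldenRatio * a := by
          rw [← hsqc]; gcongr
        have hind := goldenStep_twist (h₁ := h₁) (h₂ := h₂) hf hC hc h hA
        have hK : 0 < a + goldenRatio * a + goldenRatio * c + c := by positivity
        rw [hind.cycleWeights_eq hK]
        obtain ⟨x', n', hn, h'⟩ := hind.exists_cycle hK hit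
        -- The new lengths are again in golden proportion, so the induction hypothesis applies.
        rw [show goldenRatio * a - goldenRatio * c - c = goldenRatio * (a - goldenRatio * c) by
          linear_combination hsqc] at h' ⊢
        exact ih n' hn _ _ _ _ _ _ (by linarith) hc.le (by linarith) h'
      · have hA : goldenRatio * a < goldenRatio * c + c := by
          rw [← hsqc]; gcongr
        have hCA : goldenRatio * c ≤ goldenRatio * a := by gcongr
        have hind := goldenStep_rotate (h₁ := h₁) (h₂ := h₂) hf hc hac h hCA hA
        rw [hind.cycleWeights_eq one_pos]
        obtain ⟨x', n', hn, h'⟩ := hind.exists_cycle one_pos hit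
        rw [show goldenRatio * a + a - goldenRatio * c - c =
            goldenRatio * (goldenRatio * a - goldenRatio * c) by
              linear_combination (c - a) * hsq,
          show goldenRatio * c + c - goldenRatio * a = goldenRatio * (goldenRatio * c - a) by
              linear_combination -hsqc] at h' ⊢
        exact ih n' hn _ _ _ _ _ _ (by linarith) (by linarith) (by linarith) h'
    intro a c h₁ h₂ x w ha hc hac hit
    rcases hc.eq_or_lt with rfl | hc'
    · rw [cycleWeights_goldenStep_swap, mul_zero]
      have ha' : 0 < a := by linarith
      exact ⟨_, cycleWeights_goldenStep_degenerate (by positivity) ha'⟩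
    rcases ha.eq_or_lt with rfl | ha'
    · rw [mul_zero]
      exact ⟨_, cycleWeights_goldenStep_degenerate (by positivity) hc'⟩
    rcases le_total c a with h | h
    · exact main a c h₁ h₂ x w ha hc' h hit
    · rw [cycleWeights_goldenStep_swap]
      exact main c a h₂ h₁ _ w hc ha' h (hit_goldenStep_swap hit)

end GoldenExchange

open ComplexConjugate

/-! ### The pentagon, its symmetries, and chords in a given direction -/

section PentagonGeometry

/-- The `k`-th vertex of the pentagon, with the index taken modulo `5`. -/
noncomputable def vtx (k : ZMod 5) : ℂ := ZMod.stdAddChar k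

theorem vtx_add (j k : ZMod 5) : vtx (j + k) = vtx j * vtx k := AddChar.map_add_eq_mul _ j k

theorem vtx_zero : vtx 0 = 1 := AddChar.map_zero_eq_one _

theorem conj_vtx (k : ZMod 5) : conj (vtx k) = vtx (-k) :=
  (AddChar.map_neg_eq_conj _ k).symm

theorem vtx_mul_neg (k : ZMod 5) : vtx k * vtx (-k) = 1 := by
  rw [← vtx_add, add_neg_cancel, vtx_zero]

theorem vtx_ne_zero (k : ZMod 5) : vtx k ≠ 0 := left_ne_zero_of_mul_eq_one (vtx_mul_neg k)

theorem norm_vtx (k : ZMod 5) : ‖vtx k‖ = 1 := AddChar.norm_apply _ _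

theorem pentagonVertex_eq (k : ℕ) : pentagonVertex k = vtx k := by
  have := ZMod.stdAddChar_coe (N := 5) k
  push_cast at this
  rw [vtx, this, pentagonVertex]

theorem vtx_one_re : (vtx 1).re = (Real.goldenRatio - 1) / 2 := by
  have h := pentagonVertex_eq 1
  rw [Nat.cast_one] at h
  rw [← h, pentagonVertex, show 2 * (Real.pi : ℂ) * Complex.I * ((1 : ℕ) : ℂ) / 5 =
    ((2 * (Real.pi / 5) : ℝ) : ℂ) * Complex.I by push_cast; ring, Complex.exp_ofReal_mul_I_re,
    Real.cos_two_mul, Real.cos_pi_div_five, Real.goldenRatio]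
  nlinarith [Real.sq_sqrt (show (0 : ℝ) ≤ 5 by norm_num)]

theorem vtx_one_im_pos : 0 < (vtx 1).im := by
  have h := pentagonVertex_eq 1
  rw [Nat.cast_one] at h
  rw [← h, pentagonVertex, show 2 * (Real.pi : ℂ) * Complex.I * ((1 : ℕ) : ℂ) / 5 =
    ((2 * Real.pi / 5 : ℝ) : ℂ) * Complex.I by push_cast; ring, Complex.exp_ofReal_mul_I_im]
  apply Real.sin_pos_of_pos_of_lt_pi <;> linarith [Real.pi_pos]

theorem vtx_golden (k : ZMod 5) :
    vtx (k + 1) + vtx (k - 1) = ((Real.goldenRatio - 1 : ℝ) : ℂ) * vtx k := by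
  have h : vtx 1 + vtx (-1) = ((Real.goldenRatio - 1 : ℝ) : ℂ) := by
    rw [← conj_vtx, Complex.add_conj, vtx_one_re]
    congr 1
    ring
  rw [sub_eq_add_neg, vtx_add, vtx_add, ← h]
  ring

/-- The relative interior of the side from `vtx t` to `vtx (t + 1)`. -/
noncomputable def side (t : ZMod 5) : Set ℂ := openSegment ℝ (vtx t) (vtx (t + 1))

theorem pentagonSide_eq (t : ZMod 5) : pentagonSide t = side t := by
  have h : ((Fin.val (n := 5) t : ℕ) : ZMod 5) = t := ZMod.natCast_zmod_val (n := 5) t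
  change openSegment ℝ (pentagonVertex (Fin.val (n := 5) t))
    (pentagonVertex (Fin.val (n := 5) t + 1)) = _
  rw [pentagonVertex_eq, pentagonVertex_eq, side]
  push_cast
  rw [h]

theorem mem_side_iff {t : ZMod 5} {z : ℂ} :
    z ∈ side t ↔ ∃ r : ℝ, 0 < r ∧ r < 1 ∧ z = vtx t + r * (vtx (t + 1) - vtx t) := by
  rw [side, openSegment_eq_image']
  simp only [Set.mem_image, Set.mem_Ioo, Complex.real_smul]
  constructor
  · rintro ⟨r, ⟨h, h'⟩, rfl⟩
    exact ⟨r, h, h', rfl⟩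
  · rintro ⟨r, h, h', rfl⟩
    exact ⟨r, ⟨h, h'⟩, rfl⟩

/-- The symmetry of the pentagon which exchanges the endpoints of the `k`-th side. -/
noncomputable def sideFlip (k : ZMod 5) (z : ℂ) : ℂ := vtx (2 * k + 1) * conj z

theorem sideFlip_vtx (k t : ZMod 5) : sideFlip k (vtx t) = vtx (2 * k + 1 - t) := by
  rw [sideFlip, conj_vtx, ← vtx_add, sub_eq_add_neg]

theorem sideFlip_sideFlip (j k : ZMod 5) (z : ℂ) : sideFlip j (sideFlip k z) = vtx (2 * (j - k)) * z := by
  rw [sideFlip, sideFlip, map_mul, conj_vtx, Complex.conj_conj, ← mul_assoc, ← vtx_add]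
  congr 2
  ring

theorem sideFlip_add (k : ZMod 5) (z w : ℂ) : sideFlip k (z + w) = sideFlip k z + sideFlip k w := by
  simp [sideFlip, mul_add]

theorem sideFlip_sub (k : ZMod 5) (z w : ℂ) : sideFlip k (z - w) = sideFlip k z - sideFlip k w := by
  simp [sideFlip, mul_sub]

theorem sideFlip_real_mul (k : ZMod 5) (r : ℝ) (z : ℂ) : sideFlip k (r * z) = r * sideFlip k z := by
  simp [sideFlip, mul_left_comm]

theorem norm_sideFlip (k : ZMod 5) (z : ℂ) : ‖sideFlip k z‖ = ‖z‖ := by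
  simp [sideFlip, norm_vtx]

theorem sideFlip_self_of_mem {t : ZMod 5} {z : ℂ} (h : z ∈ side t) :
    sideFlip t z = vtx t + vtx (t + 1) - z := by
  obtain ⟨r, -, -, rfl⟩ := mem_side_iff.1 h
  rw [sideFlip_add, sideFlip_real_mul, sideFlip_sub, sideFlip_vtx, sideFlip_vtx, show 2 * t + 1 - t = t + 1 by ring,
    show 2 * t + 1 - (t + 1) = t by ring]
  ring

theorem sideFlip_mem_side {t : ZMod 5} (k : ZMod 5) {z : ℂ} (h : z ∈ side t) :
    sideFlip k z ∈ side (2 * k - t) := by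
  obtain ⟨r, h0, h1, rfl⟩ := mem_side_iff.1 h
  refine mem_side_iff.2 ⟨1 - r, by linarith, by linarith, ?_⟩
  rw [sideFlip_add, sideFlip_real_mul, sideFlip_sub, sideFlip_vtx, sideFlip_vtx,
    show 2 * k + 1 - t = 2 * k - t + 1 by ring, show 2 * k + 1 - (t + 1) = 2 * k - t by ring]
  push_cast
  ring

theorem rot_mem_side {t : ZMod 5} (k : ZMod 5) {z : ℂ} (h : z ∈ side t) :
    vtx k * z ∈ side (k + t) := by
  obtain ⟨r, h0, h1, rfl⟩ := mem_side_iff.1 h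
  refine mem_side_iff.2 ⟨r, h0, h1, ?_⟩
  rw [add_assoc, vtx_add k, vtx_add k]
  ring

/-- The axes of the two reflections are perpendicular. Since `sideFlip t` preserves the pentagon,
applying it after a bounce gives a trajectory in the same table with reversed velocity. -/
theorem reflectInSide_eq (t : ZMod 5) (v : ℂ) : reflectInSide t v = -sideFlip t v := by
  have h : ((Fin.val (n := 5) t : ℕ) : ZMod 5) = t := ZMod.natCast_zmod_val (n := 5) t
  change (pentagonVertex (Fin.val (n := 5) t + 1) - pentagonVertex (Fin.val (n := 5) t)) /
    conj (pentagonVertex (Fin.val (n := 5) t + 1) - pentagonVertex (Fin.val (n := 5) t)) *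
      conj v = _
  rw [pentagonVertex_eq, pentagonVertex_eq]
  push_cast
  rw [h, sideFlip, map_sub, conj_vtx, conj_vtx]
  have hne : vtx (-(t + 1)) - vtx (-t) ≠ 0 := by
    intro h0
    have h1 := congrArg (fun z => vtx (t + 1) * z) h0
    simp only [mul_sub, ← vtx_add, mul_zero, add_neg_cancel] at h1
    rw [show t + 1 + -t = 1 by ring, vtx_zero] at h1
    have := congrArg Complex.im h1
    simp only [Complex.sub_im, Complex.one_im, Complex.zero_im] at this
    linarith [vtx_one_im_pos]
  rw [← neg_mul]
  congr 1
  rw [div_eq_iff hne, neg_mul, mul_sub, ← vtx_add, ← vtx_add,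
    show 2 * t + 1 + -(t + 1) = t by ring, show 2 * t + 1 + -t = t + 1 by ring]
  ring

/-- The coordinate orthogonal to `u`. -/
noncomputable def transv (u z : ℂ) : ℝ := (conj u * z).im

/-- The coordinate parallel to `u`. -/
noncomputable def axial (u z : ℂ) : ℝ := (conj u * z).re

theorem transv_add (u z w : ℂ) : transv u (z + w) = transv u z + transv u w := by
  simp only [transv, mul_add, Complex.add_im]

theorem transv_sub (u z w : ℂ) : transv u (z - w) = transv u z - transv u w := by
  simp only [transv, mul_sub, Complex.sub_im]

theorem transv_real_mul (u : ℂ) (r : ℝ) (z : ℂ) : transv u (r * z) = r * transv u z := by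
  rw [transv, mul_left_comm, Complex.im_ofReal_mul, transv]

theorem axial_add (u z w : ℂ) : axial u (z + w) = axial u z + axial u w := by
  simp only [axial, mul_add, Complex.add_re]

theorem axial_sub (u z w : ℂ) : axial u (z - w) = axial u z - axial u w := by
  simp only [axial, mul_sub, Complex.sub_re]

theorem axial_real_mul (u : ℂ) (r : ℝ) (z : ℂ) : axial u (r * z) = r * axial u z := by
  rw [axial, mul_left_comm, Complex.re_ofReal_mul, axial]

variable {u : ℂ}

theorem conj_mul_self_of_norm (hu : ‖u‖ = 1) : conj u * u = 1 := by
  rw [mul_comm, Complex.mul_conj, Complex.normSq_eq_norm_sq, hu]; norm_num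

theorem transv_self (hu : ‖u‖ = 1) : transv u u = 0 := by
  rw [transv, conj_mul_self_of_norm hu]; rfl

theorem axial_self (hu : ‖u‖ = 1) : axial u u = 1 := by
  rw [axial, conj_mul_self_of_norm hu]; rfl

theorem eq_axial_mul_of_transv_eq_zero (hu : ‖u‖ = 1) {z : ℂ} (h : transv u z = 0) :
    z = (axial u z : ℂ) * u := by
  have : conj u * z = (axial u z : ℂ) := by
    apply Complex.ext
    · simp [axial]
    · simpa [transv] using h
  rw [← this, mul_comm (conj u), mul_assoc, conj_mul_self_of_norm hu, mul_one]

/-- The (signed) width of the `t`-th side seen in the direction `u`. -/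
noncomputable def width (u : ℂ) (t : ZMod 5) : ℝ := transv u (vtx (t + 1) - vtx t)

/-- The width is the scalar product of `u` with the outer normal, up to a positive factor. -/
theorem width_normal (u : ℂ) (t : ZMod 5) :
    (1 + (vtx 1).re) * width u t = (vtx 1).im * axial u (vtx t + vtx (t + 1)) := by
  have hn : (vtx 1).re * (vtx 1).re + (vtx 1).im * (vtx 1).im = 1 := by
    rw [← Complex.normSq_apply, Complex.normSq_eq_norm_sq, norm_vtx]; norm_num
  rw [width, transv, axial, add_comm t 1, vtx_add 1 t]
  have h1 : conj u * (vtx 1 * vtx t - vtx t) = (conj u * vtx t) * (vtx 1 - 1) := by ring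
  have h2 : conj u * (vtx t + vtx 1 * vtx t) = (conj u * vtx t) * (1 + vtx 1) := by ring
  rw [h1, h2, Complex.mul_im, Complex.mul_re (conj u * vtx t) (1 + vtx 1)]
  simp only [Complex.sub_re, Complex.sub_im, Complex.add_re, Complex.add_im, Complex.one_re,
    Complex.one_im]
  linear_combination (conj u * vtx t).im * hn

theorem vtx_two_re : (vtx 2).re = -Real.goldenRatio / 2 := by
  have h := congrArg Complex.re (vtx_golden 1)
  rw [Complex.re_ofReal_mul, show (1 : ZMod 5) + 1 = 2 by rfl, sub_self, vtx_zero,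
    Complex.add_re, vtx_one_re, Complex.one_re] at h
  linear_combination h + Real.goldenRatio_sq / 2

theorem vtx_re (d : ZMod 5) : (vtx d).re = (vtx (-d)).re := by
  rw [← conj_vtx, Complex.conj_re]

/-- The pentagon lies on one side of each of its sides. -/
theorem vtx_re_add_lt (d : ZMod 5) :
    ((d = 0 ∨ d = 1) ∧ (vtx d).re + (vtx (d - 1)).re = 1 + (vtx 1).re) ∨
    (d ≠ 0 ∧ d ≠ 1 ∧ (vtx d).re + (vtx (d - 1)).re < 1 + (vtx 1).re) := by
  have h0 : (vtx 0).re = 1 := by rw [vtx_zero]; rfl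
  have h4 : (vtx 4).re = (vtx 1).re := vtx_re 4
  have h3 : (vtx 3).re = (vtx 2).re := vtx_re 3
  have h2 : (vtx 2).re < (vtx 1).re := by
    rw [vtx_two_re, vtx_one_re]; linarith [Real.one_lt_goldenRatio]
  have h1 : (vtx 1).re < 1 := by
    rw [vtx_one_re]; linarith [Real.goldenRatio_lt_two]
  fin_cases d
  · left
    refine ⟨.inl rfl, ?_⟩
    change (vtx 0).re + (vtx 4).re = _
    rw [h0, h4]
  · left
    refine ⟨.inr rfl, ?_⟩
    change (vtx 1).re + (vtx 0).re = _
    rw [h0, add_comm]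
  · right
    refine ⟨show (2 : ZMod 5) ≠ 0 by decide, show (2 : ZMod 5) ≠ 1 by decide, ?_⟩
    change (vtx 2).re + (vtx 1).re < _
    linarith
  · right
    refine ⟨show (3 : ZMod 5) ≠ 0 by decide, show (3 : ZMod 5) ≠ 1 by decide, ?_⟩
    change (vtx 3).re + (vtx 2).re < _
    linarith
  · right
    refine ⟨show (4 : ZMod 5) ≠ 0 by decide, show (4 : ZMod 5) ≠ 1 by decide, ?_⟩
    change (vtx 4).re + (vtx 3).re < _
    linarith

theorem axial_normal_vtx (t k : ZMod 5) :
    axial (vtx t + vtx (t + 1)) (vtx k) = (vtx (k - t)).re + (vtx (k - t - 1)).re := by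
  rw [axial, map_add, conj_vtx, conj_vtx, add_mul, ← vtx_add, ← vtx_add, Complex.add_re]
  congr 3 <;> ring

/-- Strict convexity: the outer normal of side `t'` is maximal exactly along that side, and another
side has at least one endpoint off it. -/
theorem axial_normal_lt {t t' : ZMod 5} (hne : t ≠ t') {z z' : ℂ} (hz : z ∈ side t)
    (hz' : z' ∈ side t') :
    axial (vtx t' + vtx (t' + 1)) z < axial (vtx t' + vtx (t' + 1)) z' := by
  have hself : axial (vtx t' + vtx (t' + 1)) z' = 1 + (vtx 1).re := by
    obtain ⟨r, h0, h1, rfl⟩ := mem_side_iff.1 hz'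
    rw [axial_add, axial_real_mul, axial_sub, axial_normal_vtx, axial_normal_vtx, sub_self,
      show t' + 1 - t' = 1 by ring, sub_self, zero_sub, ← vtx_re 1, vtx_zero, Complex.one_re]
    ring
  rw [hself]
  obtain ⟨r, h0, h1, rfl⟩ := mem_side_iff.1 hz
  rw [axial_add, axial_real_mul, axial_sub, axial_normal_vtx, axial_normal_vtx]
  rcases vtx_re_add_lt (t - t') with ⟨h, e⟩ | ⟨-, -, e⟩ <;>
  rcases vtx_re_add_lt (t + 1 - t') with ⟨h', e'⟩ | ⟨-, -, e'⟩
  · exfalso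
    have h2 : t + 1 - t' = t - t' + 1 := by ring
    have h3 : t - t' ≠ 0 := sub_ne_zero.2 hne
    rw [h2] at h'
    revert h h' h3
    generalize t - t' = d
    revert d
    decide
  all_goals nlinarith

/-- A segment in the direction `u` enters the pentagon through a side of negative width and leaves
it through a side of positive width. -/
theorem width_of_chord {t t' : ZMod 5} (hne : t ≠ t') {z z' : ℂ} (hz : z ∈ side t)
    (hz' : z' ∈ side t') {r : ℝ} (hr : 0 < r) (h : z' - z = r * u) :
    0 < width u t' ∧ width u t < 0 := by
  have hc : 0 < 1 + (vtx 1).re := by rw [vtx_one_re]; linarith [Real.one_lt_goldenRatio]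
  have hs := vtx_one_im_pos
  have hcomm : ∀ w : ℂ, axial w u = axial u w := by
    intro w
    simp only [axial, Complex.mul_re, Complex.conj_re, Complex.conj_im]
    ring
  have h1 := axial_normal_lt hne hz hz'
  have h2 := axial_normal_lt hne.symm hz' hz
  have e : z' = z + r * u := by rw [← h]; ring
  rw [e, axial_add, axial_real_mul, hcomm] at h1 h2
  constructor
  · have : 0 < r * axial u (vtx t' + vtx (t' + 1)) := by linarith
    have h3 := (pos_iff_pos_of_mul_pos this).1 hr
    have h4 : 0 < (1 + (vtx 1).re) * width u t' := by rw [width_normal]; positivity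
    exact (pos_iff_pos_of_mul_pos h4).1 hc
  · have : 0 < r * -axial u (vtx t + vtx (t + 1)) := by linarith
    have h3 := (pos_iff_pos_of_mul_pos this).1 hr
    have h4 : 0 < (1 + (vtx 1).re) * -width u t := by
      rw [mul_neg, width_normal, ← mul_neg]; positivity
    have := (pos_iff_pos_of_mul_pos h4).1 hc
    linarith

/-- The transversal position of the `t`-th vertex relative to the `0`-th one. -/
noncomputable def pos (u : ℂ) (t : ZMod 5) : ℝ := transv u (vtx t) - transv u (vtx 0)

theorem pos_succ (u : ℂ) (t : ZMod 5) : pos u (t + 1) = pos u t + width u t := by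
  rw [pos, pos, width, transv_sub]; ring

/-- The point with transversal position `x` on the line through the `t`-th side. -/
noncomputable def sidePoint (u : ℂ) (t : ZMod 5) (x : ℝ) : ℂ :=
  vtx t + ((x - pos u t) / width u t : ℝ) * (vtx (t + 1) - vtx t)

/-- The transversal position `x` is taken on the `t`-th side. -/
def OnSide (u : ℂ) (t : ZMod 5) (x : ℝ) : Prop :=
  ∃ r : ℝ, 0 < r ∧ r < 1 ∧ x = pos u t + r * width u t

/-- The reflected transversal position. -/
noncomputable def mirror (u : ℂ) (t : ZMod 5) (x : ℝ) : ℝ := pos u t + pos u (t + 1) - x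

theorem mirror_mirror (u : ℂ) (t : ZMod 5) (x : ℝ) : mirror u t (mirror u t x) = x := by
  rw [mirror, mirror]; ring

theorem OnSide.mirror {t : ZMod 5} {x : ℝ} (h : OnSide u t x) : OnSide u t (mirror u t x) := by
  obtain ⟨r, h0, h1, rfl⟩ := h
  refine ⟨1 - r, by linarith, by linarith, ?_⟩
  rw [_root_.mirror, pos_succ]; ring

theorem sidePoint_mem {t : ZMod 5} {x : ℝ} (hw : width u t ≠ 0) (h : OnSide u t x) :
    sidePoint u t x ∈ side t := by
  obtain ⟨r, h0, h1, rfl⟩ := h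
  refine mem_side_iff.2 ⟨r, h0, h1, ?_⟩
  rw [sidePoint, add_sub_cancel_left, mul_div_cancel_right₀ _ hw]

theorem transv_sidePoint {t : ZMod 5} (x : ℝ) (hw : width u t ≠ 0) :
    transv u (sidePoint u t x) = x + transv u (vtx 0) := by
  rw [sidePoint, transv_add, transv_real_mul, ← width, div_mul_cancel₀ _ hw, pos]; ring

theorem onSide_of_mem {t : ZMod 5} {z : ℂ} (h : z ∈ side t) :
    OnSide u t (transv u z - transv u (vtx 0)) := by
  obtain ⟨r, h0, h1, rfl⟩ := mem_side_iff.1 h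
  refine ⟨r, h0, h1, ?_⟩
  rw [transv_add, transv_real_mul, ← width, pos]; ring

theorem eq_sidePoint_of_mem {t : ZMod 5} {z : ℂ} (hw : width u t ≠ 0) (h : z ∈ side t) :
    z = sidePoint u t (transv u z - transv u (vtx 0)) := by
  obtain ⟨r, h0, h1, rfl⟩ := mem_side_iff.1 h
  rw [sidePoint, transv_add, transv_real_mul, ← width, pos, add_sub_right_comm,
    add_sub_cancel_left, mul_div_cancel_right₀ _ hw]

theorem sidePoint_mirror {t : ZMod 5} (x : ℝ) (hw : width u t ≠ 0) :
    sidePoint u t (mirror u t x) = vtx t + vtx (t + 1) - sidePoint u t x := by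
  have : (mirror u t x - pos u t) / width u t = 1 - (x - pos u t) / width u t := by
    rw [mirror, pos_succ]; field_simp; ring
  rw [sidePoint, this, sidePoint]
  push_cast
  ring

theorem sideFlip_sidePoint {t : ZMod 5} {x : ℝ} (hw : width u t ≠ 0) (h : OnSide u t x) :
    sideFlip t (sidePoint u t x) = sidePoint u t (mirror u t x) := by
  rw [sidePoint_mirror x hw, sideFlip_self_of_mem (sidePoint_mem hw h)]

/-- The chord in the direction `u` between two sides. -/
theorem exists_chord (hu : ‖u‖ = 1) {t t' : ZMod 5} {x : ℝ} (hw : width u t < 0)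
    (hw' : 0 < width u t') (h : OnSide u t x) (h' : OnSide u t' x) :
    0 < axial u (sidePoint u t' x - sidePoint u t x) ∧
      sidePoint u t' x - sidePoint u t x =
        (axial u (sidePoint u t' x - sidePoint u t x) : ℝ) * u := by
  have hne : t ≠ t' := by rintro rfl; linarith
  have heq := eq_axial_mul_of_transv_eq_zero hu
    (z := sidePoint u t' x - sidePoint u t x)
    (by rw [transv_sub, transv_sidePoint x hw.ne, transv_sidePoint x hw'.ne', sub_self])
  refine ⟨?_, heq⟩
  set r := axial u (sidePoint u t' x - sidePoint u t x)
  have hm := sidePoint_mem hw.ne h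
  have hm' := sidePoint_mem hw'.ne' h'
  rcases lt_trichotomy r 0 with hr | hr | hr
  · have := width_of_chord (u := u) (r := -r) hne.symm hm' hm (by linarith) (by
      push_cast; rw [neg_mul, ← heq]; ring)
    linarith [this.1]
  · rw [hr, Complex.ofReal_zero, zero_mul, sub_eq_zero] at heq
    have := axial_normal_lt hne hm hm'
    rw [heq] at this
    exact absurd this (lt_irrefl _)
  · exact hr

end PentagonGeometry

/-! ### Unfolding trajectories, periods and lengths -/

section Trajectories

variable {u : ℂ} {q : ℕ → ℂ} {s : ℕ → ZMod 5}

theorem IsBilliardTrajectory.mem (h : IsBilliardTrajectory q s) (i : ℕ) : q i ∈ side (s i) := by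
  have := h.mem_side i
  rwa [pentagonSide_eq] at this

theorem IsBilliardTrajectory.ne (h : IsBilliardTrajectory q s) (i : ℕ) : q (i + 1) ≠ q i := by
  intro e
  have := axial_normal_lt (h.side_ne i) (h.mem (i + 1)) (h.mem i)
  rw [e] at this
  exact lt_irrefl _ this

theorem IsBilliardTrajectory.norm_pos (h : IsBilliardTrajectory q s) (i : ℕ) :
    0 < ‖q (i + 1) - q i‖ := norm_pos_iff.2 (sub_ne_zero.2 (h.ne i))

theorem IsBilliardTrajectory.eq_norm_mul (h : IsBilliardTrajectory q s) (i : ℕ) :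
    q (i + 1) - q i = (‖q (i + 1) - q i‖ : ℝ) * flightDirection q i := by
  rw [flightDirection, mul_div_cancel₀]
  exact_mod_cast (h.norm_pos i).ne'

theorem flightDirection_eq {i : ℕ} {r : ℝ} (hr : 0 < r) {w : ℂ} (hw : ‖w‖ = 1)
    (h : q (i + 1) - q i = r * w) : flightDirection q i = w := by
  have : (r : ℂ) ≠ 0 := by exact_mod_cast hr.ne'
  rw [flightDirection, h, norm_mul, hw, mul_one, Complex.norm_real, Real.norm_of_nonneg hr.le,
    mul_div_cancel_left₀ _ this]

theorem IsBilliardTrajectory.shift (h : IsBilliardTrajectory q s) :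
    IsBilliardTrajectory (fun i => q (i + 1)) (fun i => s (i + 1)) where
  mem_side i := h.mem_side (i + 1)
  side_ne i := h.side_ne (i + 1)
  reflect i := h.reflect (i + 1)

theorem flightDirection_sideFlip (k : ZMod 5) (q : ℕ → ℂ) (i : ℕ) :
    flightDirection (fun i => sideFlip k (q i)) i = sideFlip k (flightDirection q i) := by
  rw [flightDirection, flightDirection, ← sideFlip_sub, norm_sideFlip, div_eq_inv_mul,
    div_eq_inv_mul, ← Complex.ofReal_inv, sideFlip_real_mul]

theorem sideFlip_neg (k : ZMod 5) (z : ℂ) : sideFlip k (-z) = -sideFlip k z := by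
  simp [sideFlip]

theorem sideFlip_conjugate (k t : ZMod 5) (z : ℂ) :
    sideFlip (2 * k - t) (sideFlip k z) = sideFlip k (sideFlip t z) := by
  rw [sideFlip_sideFlip, sideFlip_sideFlip]
  congr 2
  ring

theorem sideFlip_involutive (k : ZMod 5) : Function.Involutive (sideFlip k) := fun z => by
  rw [sideFlip_sideFlip, sub_self, mul_zero, vtx_zero, one_mul]

theorem IsBilliardTrajectory.sideFlip (h : IsBilliardTrajectory q s) (k : ZMod 5) :
    IsBilliardTrajectory (fun i => sideFlip k (q i)) (fun i => 2 * k - s i : ℕ → ZMod 5) where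
  mem_side i := by
    rw [pentagonSide_eq]
    exact sideFlip_mem_side k (h.mem i)
  side_ne i e := h.side_ne i (sub_right_injective (G := ZMod 5) e)
  reflect i := by
    have := h.reflect i
    rw [reflectInSide_eq] at this
    rw [flightDirection_sideFlip, flightDirection_sideFlip, reflectInSide_eq, this, sideFlip_neg,
      sideFlip_conjugate]

/-- Follow the trajectory for one flight and reflect the pentagon in the side that is hit, so
that the new first flight is opposite to the old one. -/
theorem IsBilliardTrajectory.advance (h : IsBilliardTrajectory q s) :
    IsBilliardTrajectory (fun i => _root_.sideFlip (s 1) (q (i + 1)))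
      (fun i => 2 * s 1 - s (i + 1) : ℕ → ZMod 5) :=
  h.shift.sideFlip (s 1)

theorem IsBilliardTrajectory.flightDirection_advance (h : IsBilliardTrajectory q s) :
    flightDirection (fun i => _root_.sideFlip (s 1) (q (i + 1))) 0 = -flightDirection q 0 := by
  rw [flightDirection_sideFlip (s 1) (fun i => q (i + 1))]
  have h0 : flightDirection (fun i => q (i + 1)) 0 = flightDirection q (0 + 1) := rfl
  have := h.reflect 0
  rw [reflectInSide_eq] at this
  rw [h0, this, sideFlip_neg, zero_add, sideFlip_involutive]

/-- The transversal positions `x i` of the flights in the direction `u` of an unfolded trajectory,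
which enters the pentagon through the side `β i` and leaves it through the side `α i`. -/
structure IsCoding (u : ℂ) (x : ℕ → ℝ) (α β : ℕ → ZMod 5) : Prop where
  exit_pos : ∀ i, 0 < width u (α i)
  onExit : ∀ i, OnSide u (α i) (x i)
  entry_neg : ∀ i, width u (β i) < 0
  onEntry : ∀ i, OnSide u (β i) (x i)
  onMirror : ∀ i, OnSide u (β (i + 1)) (mirror u (α i) (x i))
  next : ∀ i, x (i + 1) = mirror u (β (i + 1)) (mirror u (α i) (x i))

/-- The rotation accumulated after `2 * i` bounces. -/
def frame (α β : ℕ → ZMod 5) (i : ℕ) : ZMod 5 := ∑ k ∈ Finset.range i, 2 * (β (k + 1) - α k)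

/-- The bounce points `q` are those of the trajectory with the given coding. -/
def Realizes (u : ℂ) (q : ℕ → ℂ) (x : ℕ → ℝ) (α β : ℕ → ZMod 5) : Prop :=
  ∀ i, q (2 * i) = vtx (-frame α β i) * sidePoint u (β i) (x i) ∧
    q (2 * i + 1) = vtx (-frame α β i) * sidePoint u (α i) (x i)

theorem frame_succ (α β : ℕ → ZMod 5) (i : ℕ) :
    frame α β (i + 1) = frame α β i + 2 * (β (i + 1) - α i) := by
  rw [frame, Finset.sum_range_succ, ← frame]

/-- A trajectory together with the sides it hits, after two flights and two reflections. -/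
noncomputable def advanceTwice (p : (ℕ → ℂ) × (ℕ → ZMod 5)) : (ℕ → ℂ) × (ℕ → ZMod 5) :=
  (fun i => sideFlip (2 * p.2 1 - p.2 2) (sideFlip (p.2 1) (p.1 (i + 2))),
    fun i => 2 * (2 * p.2 1 - p.2 2) - (2 * p.2 1 - p.2 (i + 2)))

theorem IsBilliardTrajectory.width_pos (h : IsBilliardTrajectory q s)
    (hd : flightDirection q 0 = u) : 0 < width u (s 1) ∧ width u (s 0) < 0 := by
  have he := h.eq_norm_mul 0
  rw [hd] at he
  exact width_of_chord (h.side_ne 0).symm (h.mem 0) (h.mem 1) (h.norm_pos 0) he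

theorem transv_eq_of_flightDirection (hu : ‖u‖ = 1) (h : IsBilliardTrajectory q s)
    (hd : flightDirection q 0 = u ∨ flightDirection q 0 = -u) :
    transv u (q 1) = transv u (q 0) := by
  have he := h.eq_norm_mul 0
  rw [← sub_eq_zero, ← transv_sub, he, transv_real_mul]
  rcases hd with hd | hd
  · rw [hd, transv_self hu, mul_zero]
  · have h1 : transv u (-u) = -transv u u := by simp [transv]
    rw [hd, h1, transv_self hu, neg_zero, mul_zero]

theorem transv_sideFlip_of_mem {t : ZMod 5} {z : ℂ} (h : z ∈ side t) :
    transv u (sideFlip t z) - transv u (vtx 0) = mirror u t (transv u z - transv u (vtx 0)) := by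
  rw [sideFlip_self_of_mem h, mirror, pos, pos, transv_sub, transv_add]
  ring

theorem IsBilliardTrajectory.advanceTwice {p : (ℕ → ℂ) × (ℕ → ZMod 5)}
    (h : IsBilliardTrajectory p.1 p.2) (hd : flightDirection p.1 0 = u) :
    IsBilliardTrajectory (advanceTwice p).1 (advanceTwice p).2 ∧
      flightDirection (_root_.advanceTwice p).1 0 = u := by
  have h2 := h.advance.advance
  have hd2 := h.advance.flightDirection_advance
  rw [h.flightDirection_advance, hd, neg_neg] at hd2
  exact ⟨h2, hd2⟩

theorem exists_coding (hu : ‖u‖ = 1) (h : IsBilliardTrajectory q s)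
    (hd : flightDirection q 0 = u) : ∃ x α β, IsCoding u x α β ∧ Realizes u q x α β := by
  -- `T i` is the trajectory from bounce `2 * i` on, rotated so that its first flight has direction
  -- `u` again.
  set T : ℕ → (ℕ → ℂ) × (ℕ → ZMod 5) := fun i => advanceTwice^[i] (q, s) with hT
  have hT0 : T 0 = (q, s) := rfl
  have hTs : ∀ i, T (i + 1) = advanceTwice (T i) := fun i => Function.iterate_succ_apply' _ _ _
  have hB : ∀ i, IsBilliardTrajectory (T i).1 (T i).2 ∧ flightDirection (T i).1 0 = u := by
    intro i
    induction i with
    | zero => exact ⟨h, hd⟩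
    | succ i ih => rw [hTs]; exact ih.1.advanceTwice ih.2
  have hβs : ∀ i, (T (i + 1)).2 0 = 2 * (T i).2 1 - (T i).2 2 := by
    intro i
    rw [hTs]
    simp only [advanceTwice]
    ring
  set x : ℕ → ℝ := fun i => transv u ((T i).1 0) - transv u (vtx 0) with hx
  set α : ℕ → ZMod 5 := fun i => (T i).2 1 with hα
  set β : ℕ → ZMod 5 := fun i => (T i).2 0 with hβ
  have hx1 : ∀ i, transv u ((T i).1 1) - transv u (vtx 0) = x i := fun i => by
    rw [transv_eq_of_flightDirection hu (hB i).1 (.inl (hB i).2)]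
  have hw : ∀ i, 0 < width u (α i) ∧ width u (β i) < 0 := fun i => (hB i).1.width_pos (hB i).2
  have hmir : ∀ i, transv u (sideFlip (α i) ((T i).1 2)) - transv u (vtx 0) =
      mirror u (α i) (x i) := by
    intro i
    have hadv := (hB i).1.flightDirection_advance
    rw [(hB i).2] at hadv
    have := transv_eq_of_flightDirection hu (hB i).1.advance (.inr hadv)
    rw [← hx1, ← transv_sideFlip_of_mem ((hB i).1.mem 1)]
    exact congrArg (· - transv u (vtx 0)) this
  have hmem : ∀ i, sideFlip (α i) ((T i).1 2) ∈ side (β (i + 1)) := by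
    intro i
    have := sideFlip_mem_side ((T i).2 1) ((hB i).1.mem 2)
    rw [← hβs] at this
    exact this
  refine ⟨x, α, β, ⟨fun i => (hw i).1, ?_, fun i => (hw i).2, ?_, ?_, ?_⟩, ?_⟩
  · intro i
    rw [← hx1]
    exact onSide_of_mem ((hB i).1.mem 1)
  · exact fun i => onSide_of_mem ((hB i).1.mem 0)
  · intro i
    rw [← hmir]
    exact onSide_of_mem (hmem i)
  · intro i
    rw [← hmir, ← transv_sideFlip_of_mem (hmem i)]
    have : (T (i + 1)).1 0 = sideFlip (β (i + 1)) (sideFlip (α i) ((T i).1 2)) := by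
      rw [show β (i + 1) = _ from hβs i, hTs]
      rfl
    rw [← this]
  · have hfr : ∀ i m, (T i).1 m = vtx (frame α β i) * q (2 * i + m) := by
      intro i
      induction i with
      | zero =>
        intro m
        rw [frame, Finset.range_zero, Finset.sum_empty, vtx_zero, one_mul, hT0, mul_zero, zero_add]
      | succ i ih =>
        intro m
        rw [hTs, frame_succ, vtx_add]
        simp only [advanceTwice]
        rw [← hβs, sideFlip_sideFlip, ih, show 2 * (i + 1) + m = 2 * i + (m + 2) by ring]
        ring
    intro i
    have hinv : ∀ z : ℂ, vtx (-frame α β i) * (vtx (frame α β i) * z) = z := fun z => by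
      rw [← mul_assoc, mul_comm (vtx _), vtx_mul_neg, one_mul]
    constructor
    · rw [← eq_sidePoint_of_mem (hw i).2.ne ((hB i).1.mem 0), hfr, hinv, add_zero]
    · rw [← hx1, ← eq_sidePoint_of_mem (hw i).1.ne' ((hB i).1.mem 1), hfr, hinv]

/-- The points of two such sides at position `x` would be the ends of a chord along `u`, and these
lie on sides with widths of opposite sign. Hence the position determines both the entry and the exit
side. -/
theorem onSide_unique (hu : ‖u‖ = 1) {t t' : ZMod 5} {x : ℝ} (hw : 0 < width u t * width u t')
    (h : OnSide u t x) (h' : OnSide u t' x) : t = t' := by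
  by_contra hne
  have h0 : width u t ≠ 0 := left_ne_zero_of_mul hw.ne'
  have h0' : width u t' ≠ 0 := right_ne_zero_of_mul hw.ne'
  have hm := sidePoint_mem h0 h
  have hm' := sidePoint_mem h0' h'
  have heq := eq_axial_mul_of_transv_eq_zero hu
    (z := sidePoint u t' x - sidePoint u t x)
    (by rw [transv_sub, transv_sidePoint x h0, transv_sidePoint x h0', sub_self])
  set r := axial u (sidePoint u t' x - sidePoint u t x)
  rcases lt_trichotomy r 0 with hr | hr | hr
  · have := width_of_chord (u := u) (r := -r) (Ne.symm hne) hm' hm (by linarith) (by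
      push_cast; rw [neg_mul, ← heq]; ring)
    nlinarith [this.1, this.2]
  · rw [hr, Complex.ofReal_zero, zero_mul, sub_eq_zero] at heq
    have := axial_normal_lt hne hm hm'
    rw [heq] at this
    exact absurd this (lt_irrefl _)
  · have := width_of_chord (u := u) hne hm hm' hr heq
    nlinarith [this.1, this.2]

/-- The weight of two successive flights: the length (up to a coboundary) and the rotation. -/
noncomputable def bounceWeight (u : ℂ) (t t' : ZMod 5) : ℝ × ZMod 5 :=
  (axial u (vtx t + vtx (t + 1)) - axial u (vtx t' + vtx (t' + 1)), 2 * (t' - t))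

/-- How often a cycle of the unfolded positions has to be run through until the frame closes up. -/
def closingFactor (w : ℝ × ZMod 5) : ℕ := if w.2 = 0 then 1 else 5

theorem sum_bounceWeight_snd (α β : ℕ → ZMod 5) (n : ℕ) :
    (∑ i ∈ Finset.range n, bounceWeight u (α i) (β (i + 1))).2 = frame α β n := by
  rw [Prod.snd_sum]
  rfl

namespace IsCoding

variable {x : ℕ → ℝ} {α β : ℕ → ZMod 5}

theorem flight_even (h : IsCoding u x α β) (hu : ‖u‖ = 1) (hq : Realizes u q x α β) (i : ℕ) :
    ∃ r : ℝ, 0 < r ∧ q (2 * i + 1) - q (2 * i) = r * (vtx (-frame α β i) * u) ∧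
      r = axial u (sidePoint u (α i) (x i)) - axial u (sidePoint u (β i) (x i)) := by
  obtain ⟨hr, he⟩ := exists_chord hu (h.entry_neg i) (h.exit_pos i) (h.onEntry i) (h.onExit i)
  refine ⟨_, hr, ?_, axial_sub _ _ _⟩
  rw [(hq i).1, (hq i).2, ← mul_sub, he, axial_real_mul, axial_self hu, mul_one]
  ring

/-- After folding, this flight runs against `u` from side `α i` to side `β (i + 1)` at the mirrored
position; on either side, the point reflection in the midpoint leads to the unmirrored one. -/
theorem flight_odd (h : IsCoding u x α β) (hu : ‖u‖ = 1) (hq : Realizes u q x α β) (i : ℕ) :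
    ∃ r : ℝ, 0 < r ∧
      q (2 * i + 1 + 1) - q (2 * i + 1) = r * -(vtx (-frame α β i) * sideFlip (α i) u) ∧
      r = axial u (vtx (α i) + vtx (α i + 1)) - axial u (sidePoint u (α i) (x i)) -
        (axial u (vtx (β (i + 1)) + vtx (β (i + 1) + 1)) -
          axial u (sidePoint u (β (i + 1)) (x (i + 1)))) := by
  have hα := (h.exit_pos i).ne'
  have hβ := (h.entry_neg (i + 1)).ne
  obtain ⟨hr, he⟩ := exists_chord hu (h.entry_neg (i + 1)) (h.exit_pos i) (h.onMirror i)
    (h.onExit i).mirror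
  have e1 : sidePoint u (β (i + 1)) (mirror u (α i) (x i)) =
      vtx (β (i + 1)) + vtx (β (i + 1) + 1) - sidePoint u (β (i + 1)) (x (i + 1)) := by
    rw [h.next, sidePoint_mirror _ hβ]; ring
  refine ⟨_, hr, ?_, ?_⟩
  · have e2 : sidePoint u (α i) (x i) =
        sideFlip (α i) (sidePoint u (α i) (mirror u (α i) (x i))) := by
      rw [sideFlip_sidePoint hα (h.onExit i).mirror, mirror_mirror]
    have e3 : sidePoint u (β (i + 1)) (x (i + 1)) =
        sideFlip (β (i + 1)) (sidePoint u (β (i + 1)) (mirror u (α i) (x i))) := by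
      rw [sideFlip_sidePoint hβ (h.onMirror i), h.next]
    have e4 : ∀ z, vtx (-frame α β (i + 1)) * sideFlip (β (i + 1)) z =
        vtx (-frame α β i) * sideFlip (α i) z := by
      intro z
      rw [sideFlip, sideFlip, ← mul_assoc, ← mul_assoc, ← vtx_add, ← vtx_add, frame_succ]
      congr 2
      ring
    have e5 : q (2 * i + 1 + 1) = q (2 * (i + 1)) := by congr 1
    rw [e5, (hq (i + 1)).1, (hq i).2, e3, e4, e2, ← mul_sub, ← sideFlip_sub, ← neg_sub,
      sideFlip_neg]
    nth_rewrite 1 [he]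
    rw [sideFlip_real_mul]
    ring
  · rw [sidePoint_mirror _ hα, e1]
    simp only [axial_sub]

/-- The last bracket is a coboundary, so around a cycle only the first component of `bounceWeight`
survives. -/
theorem norm_flights (h : IsCoding u x α β) (hu : ‖u‖ = 1) (hq : Realizes u q x α β) (i : ℕ) :
    ‖q (2 * i + 1) - q (2 * i)‖ + ‖q (2 * i + 1 + 1) - q (2 * i + 1)‖ =
      axial u (vtx (α i) + vtx (α i + 1)) -
        axial u (vtx (β (i + 1)) + vtx (β (i + 1) + 1)) +
      (axial u (sidePoint u (β (i + 1)) (x (i + 1))) - axial u (sidePoint u (β i) (x i))) := by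
  obtain ⟨r, hr, h1, h2⟩ := h.flight_even hu hq i
  obtain ⟨r', hr', h1', h2'⟩ := h.flight_odd hu hq i
  rw [h1, h1']
  simp only [norm_mul, norm_neg, norm_vtx, norm_sideFlip, hu, Complex.norm_real,
    Real.norm_of_nonneg hr.le, Real.norm_of_nonneg hr'.le, mul_one]
  linarith

theorem exists_trajectory (h : IsCoding u x α β) (hu : ‖u‖ = 1) :
    ∃ q s, IsBilliardTrajectory q s ∧ Realizes u q x α β := by
  set q : ℕ → ℂ := fun n => vtx (-frame α β (n / 2)) *
    sidePoint u (if Even n then β (n / 2) else α (n / 2)) (x (n / 2)) with hqdef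
  set s : ℕ → ZMod 5 := fun n => (if Even n then β (n / 2) else α (n / 2)) - frame α β (n / 2)
    with hs
  have hq : Realizes u q x α β := by
    intro i
    have h1 : (2 * i + 1) / 2 = i := by omega
    have h2 : 2 * i / 2 = i := by omega
    have h3 : ¬ Even (2 * i + 1) := by simp
    constructor
    · simp only [hqdef, h2, even_two_mul, if_true]
    · simp only [hqdef, h1, h3, if_false]
  have hs0 : ∀ i, s (2 * i) = β i - frame α β i := by
    intro i
    have h2 : 2 * i / 2 = i := by omega
    simp only [hs, h2, even_two_mul, if_true]
  have hs1 : ∀ i, s (2 * i + 1) = α i - frame α β i := by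
    intro i
    have h1 : (2 * i + 1) / 2 = i := by omega
    have h3 : ¬ Even (2 * i + 1) := by simp
    simp only [hs, h1, h3, if_false]
  have hs2 : ∀ i, s (2 * i + 1 + 1) = β (i + 1) - frame α β (i + 1) := fun i => hs0 (i + 1)
  have hne : ∀ i, β (i + 1) ≠ α i := by
    intro i e
    have h1 := h.exit_pos i
    have h2 := h.entry_neg (i + 1)
    rw [e] at h2
    linarith
  have hd0 : ∀ i, flightDirection q (2 * i) = vtx (-frame α β i) * u := by
    intro i
    obtain ⟨r, hr, h1, -⟩ := h.flight_even hu hq i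
    exact flightDirection_eq hr (by rw [norm_mul, norm_vtx, hu, one_mul]) h1
  have hd1 : ∀ i, flightDirection q (2 * i + 1) = -(vtx (-frame α β i) * sideFlip (α i) u) := by
    intro i
    obtain ⟨r, hr, h1, -⟩ := h.flight_odd hu hq i
    exact flightDirection_eq hr
      (by rw [norm_neg, norm_mul, norm_vtx, norm_sideFlip, hu, one_mul]) h1
  refine ⟨q, s, ⟨fun n => ?_, fun n => ?_, fun n => ?_⟩, hq⟩
  · rw [pentagonSide_eq]
    obtain ⟨i, rfl | rfl⟩ := n.even_or_odd'
    · rw [(hq i).1, hs0, sub_eq_neg_add]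
      exact rot_mem_side _ (sidePoint_mem (h.entry_neg i).ne (h.onEntry i))
    · rw [(hq i).2, hs1, sub_eq_neg_add]
      exact rot_mem_side _ (sidePoint_mem (h.exit_pos i).ne' (h.onExit i))
  · obtain ⟨i, rfl | rfl⟩ := n.even_or_odd'
    · rw [hs1, hs0]
      intro e
      have e' : α i = β i := sub_left_injective (G := ZMod 5) e
      have h1 := h.exit_pos i
      have h2 := h.entry_neg i
      rw [e'] at h1
      linarith
    · rw [hs2, hs1, frame_succ]
      intro e
      have e' : β (i + 1) - (frame α β i + 2 * (β (i + 1) - α i)) = α i - frame α β i := e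
      exact hne i (by linear_combination -e')
  · obtain ⟨i, rfl | rfl⟩ := n.even_or_odd'
    · rw [hd1, hs1, hd0, reflectInSide_eq, sideFlip, sideFlip, map_mul, conj_vtx, ← mul_assoc,
        ← mul_assoc, ← vtx_add, ← vtx_add]
      congr 3
      ring
    · have e0 : flightDirection q (2 * i + 1 + 1) = vtx (-frame α β (i + 1)) * u := hd0 (i + 1)
      rw [e0, hs2, hd1, reflectInSide_eq, sideFlip_neg, neg_neg, sideFlip, sideFlip, map_mul,
        map_mul, conj_vtx, conj_vtx, Complex.conj_conj, ← mul_assoc, ← mul_assoc, ← vtx_add,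
        ← vtx_add, frame_succ]
      congr 2
      ring

theorem eq_of_eq (h : IsCoding u x α β) (hu : ‖u‖ = 1) {i j : ℕ} (hx : x i = x j) :
    x (i + 1) = x (j + 1) ∧ α i = α j ∧ β i = β j ∧ β (i + 1) = β (j + 1) := by
  have hα : α i = α j := onSide_unique hu (mul_pos (h.exit_pos i) (h.exit_pos j)) (h.onExit i)
    (hx ▸ h.onExit j)
  have hβ : β i = β j := onSide_unique hu
    (mul_pos_of_neg_of_neg (h.entry_neg i) (h.entry_neg j)) (h.onEntry i) (hx ▸ h.onEntry j)
  have hβ' : β (i + 1) = β (j + 1) := onSide_unique hu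
    (mul_pos_of_neg_of_neg (h.entry_neg _) (h.entry_neg _)) (h.onMirror i)
    (by rw [hx, hα]; exact h.onMirror j)
  exact ⟨by rw [h.next, h.next, hx, hα, hβ'], hα, hβ, hβ'⟩

theorem add_eq (h : IsCoding u x α β) (hu : ‖u‖ = 1) {M : ℕ} (hx : x M = x 0) (i : ℕ) :
    x (M + i) = x i := by
  induction i with
  | zero => exact hx
  | succ i ih => exact (h.eq_of_eq hu ih).1

theorem frame_add (h : IsCoding u x α β) (hu : ‖u‖ = 1) {M : ℕ} (hx : x M = x 0) (i : ℕ) :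
    frame α β (M + i) = frame α β M + frame α β i := by
  refine (Finset.sum_range_add _ M i).trans (congrArg (frame α β M + ·) ?_)
  refine Finset.sum_congr rfl fun k _ => ?_
  obtain ⟨-, h1, -, h2⟩ := h.eq_of_eq hu (h.add_eq hu hx k)
  rw [h1, ← h2]

/-- A period restores the first flight: its direction forces the rotation to vanish, and then its
line forces the position to agree. Conversely, position and rotation determine the rest of the
trajectory. -/
theorem periodic_iff (h : IsCoding u x α β) (hu : ‖u‖ = 1) (hq : Realizes u q x α β) (M : ℕ) :
    Function.Periodic q (2 * M) ↔ x M = x 0 ∧ frame α β M = 0 := by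
  have hf0 : frame α β 0 = 0 := by rw [frame, Finset.range_zero, Finset.sum_empty]
  constructor
  · intro hp
    have h0 : q (2 * M) = q 0 := by simpa using hp 0
    have h1 : q (2 * M + 1) = q 1 := by simpa [add_comm] using hp 1
    obtain ⟨r, hr, e, -⟩ := h.flight_even hu hq M
    obtain ⟨r', hr', e', -⟩ := h.flight_even hu hq 0
    have hun : u ≠ 0 := norm_ne_zero_iff.1 (by rw [hu]; exact one_ne_zero)
    rw [hf0, neg_zero, vtx_zero, one_mul, mul_zero, zero_add] at e'
    rw [h0, h1, e', ← mul_assoc] at e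
    have e2 := mul_right_cancel₀ hun e
    have e3 := congrArg norm e2
    rw [norm_mul, norm_vtx, mul_one, Complex.norm_real, Complex.norm_real,
      Real.norm_of_nonneg hr.le, Real.norm_of_nonneg hr'.le] at e3
    have hrc : (r : ℂ) ≠ 0 := by exact_mod_cast hr.ne'
    have hv : vtx (-frame α β M) = 1 := by
      rw [e3] at e2
      exact (mul_left_cancel₀ hrc (by rw [mul_one]; exact e2)).symm
    have hfr : frame α β M = 0 := by
      rw [← vtx_zero] at hv
      exact neg_eq_zero.1 (ZMod.injective_stdAddChar hv)
    refine ⟨?_, hfr⟩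
    have e4 := (hq M).1
    have e5 := (hq 0).1
    rw [mul_zero, hf0, neg_zero, vtx_zero, one_mul] at e5
    rw [h0, e5, hfr, neg_zero, vtx_zero, one_mul] at e4
    have e6 := congrArg (transv u) e4
    rw [transv_sidePoint _ (h.entry_neg _).ne, transv_sidePoint _ (h.entry_neg _).ne] at e6
    linarith
  · rintro ⟨hx, hfr⟩ n
    have hx' := h.add_eq hu hx
    have hfr' : ∀ i, frame α β (M + i) = frame α β i := fun i => by
      rw [h.frame_add hu hx, hfr, zero_add]
    obtain ⟨i, rfl | rfl⟩ := n.even_or_odd'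
    · obtain ⟨-, -, h1, -⟩ := h.eq_of_eq hu (hx' i)
      rw [show 2 * i + 2 * M = 2 * (M + i) by ring, (hq _).1, (hq _).1, hx', hfr', h1]
    · obtain ⟨-, h1, -, -⟩ := h.eq_of_eq hu (hx' i)
      rw [show 2 * i + 1 + 2 * M = 2 * (M + i) + 1 by ring, (hq _).2, (hq _).2, hx', hfr', h1]

theorem sum_mul (h : IsCoding u x α β) (hu : ‖u‖ = 1) {n : ℕ} (hx : x n = x 0) (k : ℕ) :
    x (n * k) = x 0 ∧ ∑ i ∈ Finset.range (n * k), bounceWeight u (α i) (β (i + 1)) =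
      k • ∑ i ∈ Finset.range n, bounceWeight u (α i) (β (i + 1)) := by
  induction k with
  | zero => simp
  | succ k ih =>
    refine ⟨by rw [mul_add, mul_one, add_comm, h.add_eq hu hx, ih.1], ?_⟩
    rw [mul_add, mul_one, Finset.sum_range_add, ih.2, succ_nsmul]
    congr 1
    refine Finset.sum_congr rfl fun i _ => ?_
    obtain ⟨-, h1, -, h2⟩ := h.eq_of_eq hu (h.add_eq hu ih.1 i)
    rw [h1, ← h2]

/-- Positions recur exactly at multiples of `n`, and after `n * k` steps the rotation is `k • w.2`.
As 5 is prime, it first vanishes at `k = 1` or `k = 5`. -/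
theorem isLeastEvenPeriod (h : IsCoding u x α β) (hu : ‖u‖ = 1) (hq : Realizes u q x α β) {n : ℕ}
    (hn : 0 < n) (hx : x n = x 0) (hmin : ∀ k, 0 < k → k < n → x k ≠ x 0) {w : ℝ × ZMod 5}
    (hw : ∑ i ∈ Finset.range n, bounceWeight u (α i) (β (i + 1)) = w) :
    IsLeastEvenPeriod q (2 * (n * closingFactor w)) := by
  have hfr : ∀ k, frame α β (n * k) = k • w.2 := by
    intro k
    rw [← sum_bounceWeight_snd (u := u), (h.sum_mul hu hx k).2, hw, Prod.smul_snd]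
  have hmul : 0 < closingFactor w ∧ closingFactor w • w.2 = 0 := by
    unfold closingFactor
    split_ifs with h0
    · simp [h0]
    · exact ⟨by norm_num, by rw [nsmul_eq_mul, show ((5 : ℕ) : ZMod 5) = 0 from rfl, zero_mul]⟩
  refine ⟨⟨by have := hmul.1; positivity, even_two_mul _, ?_⟩, ?_⟩
  · rw [h.periodic_iff hu hq]
    exact ⟨(h.sum_mul hu hx _).1, by rw [hfr, hmul.2]⟩
  · rintro m ⟨hm, he, hp⟩
    obtain ⟨M, rfl⟩ := even_iff_exists_two_mul.1 he
    obtain ⟨hxM, hfM⟩ := (h.periodic_iff hu hq M).1 hp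
    have hdiv : n ∣ M := by
      by_contra hnd
      have hlt := Nat.mod_lt M hn
      have hpos : 0 < M % n := Nat.pos_of_ne_zero fun e => hnd (Nat.dvd_of_mod_eq_zero e)
      apply hmin _ hpos hlt
      rw [← h.add_eq hu (h.sum_mul hu hx (M / n)).1, Nat.div_add_mod, hxM]
    obtain ⟨k, rfl⟩ := hdiv
    have hk : 0 < k := Nat.pos_of_ne_zero fun e => by simp [e] at hm
    rw [hfr, nsmul_eq_mul] at hfM
    apply Nat.mul_le_mul_left
    apply Nat.mul_le_mul_left
    unfold closingFactor
    split_ifs with h0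
    · exact hk
    · have : Fact (Nat.Prime 5) := ⟨by norm_num⟩
      have := (mul_eq_zero.1 hfM).resolve_right h0
      exact Nat.le_of_dvd hk ((ZMod.natCast_eq_zero_iff k 5).1 this)

theorem sum_norm (h : IsCoding u x α β) (hu : ‖u‖ = 1) (hq : Realizes u q x α β) (M : ℕ) :
    ∑ i ∈ Finset.range (2 * M), ‖q (i + 1) - q i‖ =
      (∑ i ∈ Finset.range M, bounceWeight u (α i) (β (i + 1))).1 +
      (axial u (sidePoint u (β M) (x M)) - axial u (sidePoint u (β 0) (x 0))) := by
  induction M with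
  | zero => simp
  | succ M ih =>
    rw [mul_add, mul_one, Finset.sum_range_succ, Finset.sum_range_succ, ih, add_assoc,
      h.norm_flights hu hq, Finset.sum_range_succ, Prod.fst_add]
    simp only [bounceWeight]
    ring

theorem length_eq (h : IsCoding u x α β) (hu : ‖u‖ = 1) (hq : Realizes u q x α β) {n : ℕ}
    (hx : x n = x 0) {w : ℝ × ZMod 5}
    (hw : ∑ i ∈ Finset.range n, bounceWeight u (α i) (β (i + 1)) = w) :
    ∑ i ∈ Finset.range (2 * (n * closingFactor w)), ‖q (i + 1) - q i‖ =
      closingFactor w * w.1 := by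
  obtain ⟨h1, h2⟩ := h.sum_mul hu hx (closingFactor w)
  obtain ⟨-, -, h3, -⟩ := h.eq_of_eq hu h1
  rw [h.sum_norm hu hq, h2, hw, h1, h3, sub_self, add_zero, Prod.smul_fst, nsmul_eq_mul]

end IsCoding

end Trajectories

/-! ### First-return walks and infinite orbits -/

section Sequences

variable {X V : Type*} [AddCommGroup V] {S : X → X → V → Prop}

theorem hit_of_sequence {x : ℕ → X} {w : ℕ → V} (h : ∀ i, S (x i) (x (i + 1)) (w i)) {y : X}
    (m : ℕ) : ∀ k, x (k + m + 1) = y → (∀ j, 0 < j → j ≤ m → x (k + j) ≠ y) →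
      Hit S y (m + 1) (x k) (∑ i ∈ Finset.range (m + 1), w (k + i)) := by
  induction m with
  | zero =>
    rintro k rfl -
    simpa using Hit.last (h k)
  | succ m ih =>
    intro k hy hne
    rw [Finset.sum_range_succ', add_comm (∑ i ∈ _, _)]
    refine .cons (h k) (hne 1 one_pos (by omega)) ?_
    have := ih (k + 1) (by rw [← hy]; congr 1; ring) fun j hj hj' => by
      rw [add_assoc, add_comm 1]
      exact hne (j + 1) (by omega) (by omega)
    simpa only [add_assoc, add_comm 1] using this

theorem Hit.sequence (hS : IsDet S) {p y : X} {n : ℕ} {W : V} (hit : Hit S y n p W) :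
    ∀ (x : ℕ → X) (w : ℕ → V), (∀ i, S (x i) (x (i + 1)) (w i)) → x 0 = p →
      x n = y ∧ ∑ i ∈ Finset.range n, w i = W ∧ ∀ j, 0 < j → j < n → x j ≠ y := by
  induction hit with
  | last h =>
    rintro x w hx rfl
    obtain ⟨h1, h2⟩ := hS (hx 0) h
    exact ⟨h1, by simpa using h2, fun j _ _ => by omega⟩
  | cons h hne _ ih =>
    rintro x w hx rfl
    obtain ⟨h1, h2⟩ := hS (hx 0) h
    obtain ⟨e1, e2, e3⟩ := ih (fun i => x (i + 1)) (fun i => w (i + 1)) (fun i => hx (i + 1)) h1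
    refine ⟨e1, by rw [Finset.sum_range_succ', e2, h2, add_comm], fun j hj hj' => ?_⟩
    obtain ⟨j, rfl⟩ : ∃ i, j = i + 1 := ⟨j - 1, by omega⟩
    rcases j.eq_zero_or_pos with rfl | hj₀
    · rw [zero_add] at *
      exact h1 ▸ hne
    · exact e3 j hj₀ (by omega)

theorem IsCyclicPt.exists_sequence (hS : IsDet S) {p : X} (h : IsCyclicPt S p) :
    ∃ (x : ℕ → X) (w : ℕ → V), x 0 = p ∧ ∀ i, S (x i) (x (i + 1)) (w i) := by
  choose f w hf using fun z : {z // IsCyclicPt S z} => z.2.step hS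
  let F : {z // IsCyclicPt S z} → {z // IsCyclicPt S z} := fun z => ⟨f z, (hf z).2⟩
  refine ⟨fun i => (F^[i] ⟨p, h⟩).1, fun i => w (F^[i] ⟨p, h⟩), rfl, fun i => ?_⟩
  simp only [Function.iterate_succ_apply']
  exact (hf _).1

end Sequences

/-! ### The golden exchange of a direction in the basic sector -/

section Sector

variable {u : ℂ}

theorem width_golden (u : ℂ) (t : ZMod 5) :
    width u (t + 1) + width u (t - 1) = (Real.goldenRatio - 1) * width u t := by
  have h : vtx (t + 1 + 1) - vtx (t + 1) + (vtx (t - 1 + 1) - vtx (t - 1)) =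
      ((Real.goldenRatio - 1 : ℝ) : ℂ) * (vtx (t + 1) - vtx t) := by
    have h1 := vtx_golden (t + 1)
    have h2 := vtx_golden t
    rw [add_sub_cancel_right] at h1
    rw [sub_add_cancel, mul_sub, ← h1, ← h2]
    ring
  rw [width, width, ← transv_add, h, transv_real_mul, width]

theorem width_succ (u : ℂ) (t : ZMod 5) :
    width u (t + 1) = Real.goldenRatio * (width u t + width u (t + 2)) := by
  have h := width_golden u (t + 1)
  rw [add_sub_cancel_right, show t + 1 + 1 = t + 2 by ring] at h
  linear_combination -Real.goldenRatio * h - width u (t + 1) * Real.goldenRatio_sq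

theorem onSide_iff_of_pos {t : ZMod 5} {x : ℝ} (hw : 0 < width u t) :
    OnSide u t x ↔ pos u t < x ∧ x < pos u (t + 1) := by
  rw [pos_succ]
  constructor
  · rintro ⟨r, h0, h1, rfl⟩
    constructor <;> nlinarith
  · rintro ⟨h0, h1⟩
    refine ⟨(x - pos u t) / width u t, div_pos (by linarith) hw, ?_, ?_⟩
    · rw [div_lt_one hw]; linarith
    · rw [div_mul_cancel₀ _ hw.ne']; ring

theorem onSide_iff_of_neg {t : ZMod 5} {x : ℝ} (hw : width u t < 0) :
    OnSide u t x ↔ pos u (t + 1) < x ∧ x < pos u t := by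
  rw [pos_succ]
  constructor
  · rintro ⟨r, h0, h1, rfl⟩
    constructor <;> nlinarith
  · rintro ⟨h0, h1⟩
    refine ⟨(x - pos u t) / width u t, div_pos_of_neg_of_neg (by linarith) hw, ?_, ?_⟩
    · rw [div_lt_one_of_neg hw]; linarith
    · rw [div_mul_cancel₀ _ hw.ne]; ring

/-- The factor `(φ, 3)`, where `3` is a root of `X ^ 2 = X + 1` modulo `5`. -/
noncomputable def goldenPair : ℝ × ZMod 5 := (Real.goldenRatio, 3)

theorem goldenPair_mul_self : goldenPair * goldenPair = goldenPair + 1 := by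
  refine Prod.ext ?_ ?_
  · change Real.goldenRatio * Real.goldenRatio = Real.goldenRatio + 1
    rw [← sq, Real.goldenRatio_sq]
  · change (3 : ZMod 5) * 3 = 3 + 1
    rfl

/-- A diagonal plus the side parallel to it is φ times the diagonal, here `vtx 1 - vtx 4` and `vtx 2
- vtx 3`. The rotations are 3 and `3 * 3 = 4` modulo 5. -/
theorem goldenPair_mul_bounceWeight_zero (u : ℂ) :
    goldenPair * bounceWeight u 0 4 = bounceWeight u 1 3 := by
  have h1 := vtx_golden 1
  have h4 := vtx_golden 4
  rw [show (1 : ZMod 5) + 1 = 2 from rfl, show (1 : ZMod 5) - 1 = 0 from rfl] at h1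
  rw [show (4 : ZMod 5) + 1 = 0 from rfl, show (4 : ZMod 5) - 1 = 3 from rfl] at h4
  refine Prod.ext ?_ ?_
  · change Real.goldenRatio * (axial u (vtx 0 + vtx 1) - axial u (vtx 4 + vtx 0)) =
      axial u (vtx 1 + vtx 2) - axial u (vtx 3 + vtx 4)
    rw [← axial_sub, ← axial_sub, ← axial_real_mul]
    congr 1
    push_cast at h1 h4 ⊢
    linear_combination h4 - h1
  · change (3 : ZMod 5) * (2 * (4 - 0)) = 2 * (3 - 1)
    rfl

theorem goldenPair_mul_bounceWeight_two (u : ℂ) :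
    goldenPair * bounceWeight u 2 3 = bounceWeight u 1 4 := by
  have h1 := vtx_golden 2
  have h4 := vtx_golden 4
  rw [show (2 : ZMod 5) + 1 = 3 from rfl, show (2 : ZMod 5) - 1 = 1 from rfl] at h1
  rw [show (4 : ZMod 5) + 1 = 0 from rfl, show (4 : ZMod 5) - 1 = 3 from rfl] at h4
  refine Prod.ext ?_ ?_
  · change Real.goldenRatio * (axial u (vtx 2 + vtx 3) - axial u (vtx 3 + vtx 4)) =
      axial u (vtx 1 + vtx 2) - axial u (vtx 4 + vtx 0)
    rw [← axial_sub, ← axial_sub, ← axial_real_mul]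
    congr 1
    push_cast at h1 h4 ⊢
    linear_combination h4 - h1
  · change (3 : ZMod 5) * (2 * (3 - 2)) = 2 * (4 - 1)
    rfl

/-- The exchange of intervals that describes the billiard flow in the direction `u`. -/
def PentagonStep (u : ℂ) : ℝ → ℝ → ℝ × ZMod 5 → Prop :=
  GoldenStep (width u 0) (Real.goldenRatio * width u 0) (Real.goldenRatio * width u 2) (width u 2)
    goldenPair (bounceWeight u 0 4) (bounceWeight u 2 3)

theorem pentagonStep_isDet (ha : 0 ≤ width u 0) (hc : 0 < width u 2) :
    IsDet (PentagonStep u) := by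
  have := Real.goldenRatio_pos
  exact GoldenStep.isDet (by positivity) (by positivity)

theorem sector_widths (u : ℂ) :
    width u 1 = Real.goldenRatio * width u 0 + Real.goldenRatio * width u 2 ∧
    width u 3 = -(Real.goldenRatio * width u 0 + width u 2) ∧
    width u 4 = -(width u 0 + Real.goldenRatio * width u 2) := by
  have h1 := width_succ u 0
  have h2 := width_golden u 2
  have h3 := width_golden u 0
  rw [show (0 : ZMod 5) + 1 = 1 from rfl, show (0 : ZMod 5) + 2 = 2 from rfl] at h1
  rw [show (2 : ZMod 5) + 1 = 3 from rfl, show (2 : ZMod 5) - 1 = 1 from rfl] at h2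
  rw [show (0 : ZMod 5) + 1 = 1 from rfl, show (0 : ZMod 5) - 1 = 4 from rfl] at h3
  refine ⟨by linear_combination h1, ?_, ?_⟩
  · linear_combination h2 - h1
  · linear_combination h3 - h1

theorem sector_pos (u : ℂ) :
    pos u 0 = 0 ∧ pos u 1 = width u 0 ∧
    pos u 2 = width u 0 + Real.goldenRatio * width u 0 + Real.goldenRatio * width u 2 ∧
    pos u 3 = width u 0 + Real.goldenRatio * width u 0 + Real.goldenRatio * width u 2 +
      width u 2 ∧
    pos u 4 = width u 0 + Real.goldenRatio * width u 2 := by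
  obtain ⟨w1, w3, w4⟩ := sector_widths u
  have p0 : pos u 0 = 0 := sub_self _
  have p1 : pos u 1 = pos u 0 + width u 0 := pos_succ u 0
  have p2 : pos u 2 = pos u 1 + width u 1 := pos_succ u 1
  have p3 : pos u 3 = pos u 2 + width u 2 := pos_succ u 2
  have p4 : pos u 0 = pos u 4 + width u 4 := pos_succ u 4
  refine ⟨p0, ?_, ?_, ?_, ?_⟩ <;> linarith

theorem zmod_five_cases : ∀ t : ZMod 5, t = 0 ∨ t = 1 ∨ t = 2 ∨ t = 3 ∨ t = 4 := by decide

/-- The exit sides are among 0, 1, 2 and the entry sides are 3, 4. The pairs (0, 3) and (2, 4)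
cannot occur; (0, 4), (1, 3), (1, 4), (2, 3) are the four intervals in order. -/
theorem pentagonStep_of_onSide (ha : 0 ≤ width u 0) (hc : 0 < width u 2) {t t' : ZMod 5} {x : ℝ}
    (ht : 0 < width u t) (ht' : width u t' < 0) (h : OnSide u t x)
    (h' : OnSide u t' (mirror u t x)) :
    PentagonStep u x (mirror u t' (mirror u t x)) (bounceWeight u t t') := by
  obtain ⟨w1, w3, w4⟩ := sector_widths u
  obtain ⟨p0, p1, p2, p3, p4⟩ := sector_pos u
  have hg := Real.goldenRatio_pos
  have hC : 0 < Real.goldenRatio * width u 2 := by positivity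
  have hA : 0 ≤ Real.goldenRatio * width u 0 := by positivity
  rw [onSide_iff_of_pos ht] at h
  rw [onSide_iff_of_neg ht'] at h'
  unfold PentagonStep GoldenStep
  rw [goldenPair_mul_bounceWeight_zero, goldenPair_mul_bounceWeight_two]
  unfold mirror at *
  have ht₁ : t = 0 ∨ t = 1 ∨ t = 2 := by
    rcases zmod_five_cases t with rfl | rfl | rfl | rfl | rfl
    · simp
    · simp
    · simp
    · linarith
    · linarith
  have ht₂ : t' = 3 ∨ t' = 4 := by
    rcases zmod_five_cases t' with rfl | rfl | rfl | rfl | rfl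
    · linarith
    · linarith
    · linarith
    · simp
    · simp
  rcases ht₁ with rfl | rfl | rfl <;> rcases ht₂ with rfl | rfl <;>
  simp only [show (0 : ZMod 5) + 1 = 1 from rfl, show (1 : ZMod 5) + 1 = 2 from rfl,
    show (2 : ZMod 5) + 1 = 3 from rfl, show (3 : ZMod 5) + 1 = 4 from rfl,
    show (4 : ZMod 5) + 1 = 0 from rfl, p0, p1, p2, p3, p4] at h h' ⊢
  · exfalso; linarith
  · left
    refine ⟨?_, ?_, ?_, trivial⟩ <;> linarith
  · right; left
    refine ⟨?_, ?_, ?_, trivial⟩ <;> linarith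
  · right; right; left
    refine ⟨?_, ?_, ?_, trivial⟩ <;> linarith
  · right; right; right
    refine ⟨?_, ?_, ?_, trivial⟩ <;> linarith
  · exfalso; linarith

theorem exists_onSide_of_pentagonStep (ha : 0 ≤ width u 0) (hc : 0 < width u 2) {x y : ℝ}
    {w : ℝ × ZMod 5} (h : PentagonStep u x y w) : ∃ t t', 0 < width u t ∧ width u t' < 0 ∧
      OnSide u t x ∧ OnSide u t' (mirror u t x) ∧ y = mirror u t' (mirror u t x) ∧
      w = bounceWeight u t t' := by
  obtain ⟨w1, w3, w4⟩ := sector_widths u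
  obtain ⟨p0, p1, p2, p3, p4⟩ := sector_pos u
  have hg := Real.goldenRatio_pos
  have hC : 0 < Real.goldenRatio * width u 2 := by positivity
  have hA : 0 ≤ Real.goldenRatio * width u 0 := by positivity
  have hw1 : 0 < width u 1 := by linarith
  have hw3 : width u 3 < 0 := by linarith
  have hw4 : width u 4 < 0 := by linarith
  unfold PentagonStep GoldenStep at h
  rw [goldenPair_mul_bounceWeight_zero, goldenPair_mul_bounceWeight_two] at h
  rcases h with ⟨k, k', rfl, rfl⟩ | ⟨k, k', rfl, rfl⟩ | ⟨k, k', rfl, rfl⟩ | ⟨k, k', rfl, rfl⟩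
  · have hw0 : 0 < width u 0 := by linarith
    refine ⟨0, 4, hw0, hw4, (onSide_iff_of_pos hw0).2 ?_, (onSide_iff_of_neg hw4).2 ?_, ?_, rfl⟩ <;>
    simp only [mirror, show (0 : ZMod 5) + 1 = 1 from rfl, show (4 : ZMod 5) + 1 = 0 from rfl, p0,
      p1, p4]
    · constructor <;> linarith
    · constructor <;> linarith
    · ring
  · refine ⟨1, 3, hw1, hw3, (onSide_iff_of_pos hw1).2 ?_, (onSide_iff_of_neg hw3).2 ?_, ?_, rfl⟩ <;>
    simp only [mirror, show (1 : ZMod 5) + 1 = 2 from rfl, show (3 : ZMod 5) + 1 = 4 from rfl, p1,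
      p2, p3, p4]
    · constructor <;> linarith
    · constructor <;> linarith
    · ring
  · refine ⟨1, 4, hw1, hw4, (onSide_iff_of_pos hw1).2 ?_, (onSide_iff_of_neg hw4).2 ?_, ?_, rfl⟩ <;>
    simp only [mirror, show (1 : ZMod 5) + 1 = 2 from rfl, show (4 : ZMod 5) + 1 = 0 from rfl, p0,
      p1, p2, p4]
    · constructor <;> linarith
    · constructor <;> linarith
    · ring
  · refine ⟨2, 3, hc, hw3, (onSide_iff_of_pos hc).2 ?_, (onSide_iff_of_neg hw3).2 ?_, ?_, rfl⟩ <;>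
    simp only [mirror, show (2 : ZMod 5) + 1 = 3 from rfl, show (3 : ZMod 5) + 1 = 4 from rfl, p2,
      p3, p4]
    · constructor <;> linarith
    · constructor <;> linarith
    · ring

end Sector

/-! ### From cycle weights to lengths, and reduction to the sector -/

section Lengths

variable {u : ℂ} {q : ℕ → ℂ} {s : ℕ → ZMod 5}

theorem mem_closedTrajectoryLengths {v : ℂ} {l : ℝ} : l ∈ closedTrajectoryLengths v ↔
    ∃ (q : ℕ → ℂ) (s : ℕ → ZMod 5) (m : ℕ), IsBilliardTrajectory q s ∧
      (∃ r : ℝ, q 1 - q 0 = r • v) ∧ IsLeastEvenPeriod q m ∧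
      l = ∑ i ∈ Finset.range m, ‖q (i + 1) - q i‖ := Iff.rfl

theorem length_pos {v : ℂ} {l : ℝ} (hl : l ∈ closedTrajectoryLengths v) : 0 < l := by
  obtain ⟨q, s, m, h, -, hm, rfl⟩ := hl
  refine Finset.sum_pos (fun i _ => h.norm_pos i) ?_
  exact Finset.nonempty_range_iff.2 hm.1.1.ne'

theorem length_mem_of_cycleWeight (hu : ‖u‖ = 1) (ha : 0 ≤ width u 0) (hc : 0 < width u 2)
    {w : ℝ × ZMod 5} (hw : w ∈ cycleWeights (PentagonStep u)) :
    (closingFactor w : ℝ) * w.1 ∈ closedTrajectoryLengths u := by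
  have hdet := pentagonStep_isDet ha hc
  obtain ⟨p, n, hit⟩ := hw
  have hcyc : IsCyclicPt (PentagonStep u) p := ⟨n, w, hit⟩
  obtain ⟨x, W, rfl, hx⟩ := hcyc.exists_sequence hdet
  obtain ⟨o, wo, ho⟩ := hcyc.pred
  obtain ⟨hn, hsum, hmin⟩ := hit.sequence hdet x W hx rfl
  choose α γ hα hγ hxα hxγ hnext hWγ using fun i => exists_onSide_of_pentagonStep ha hc (hx i)
  obtain ⟨t, t', -, ht', -, hot', he, -⟩ := exists_onSide_of_pentagonStep ha hc ho
  -- The orbit itself gives only the later entry sides; the first comes from a predecessor of `x 0`.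
  let β : ℕ → ZMod 5 := fun i => Nat.casesOn i t' γ
  have hcod : IsCoding u x α β :=
    { exit_pos := hα
      onExit := hxα
      entry_neg := fun i => by
        cases i with
        | zero => exact ht'
        | succ i => exact hγ i
      onEntry := fun i => by
        cases i with
        | zero => rw [he]; exact hot'.mirror
        | succ i => rw [hnext]; exact (hxγ i).mirror
      onMirror := hxγ
      next := hnext }
  obtain ⟨q, s, hq, hr⟩ := hcod.exists_trajectory hu
  have hs : ∑ i ∈ Finset.range n, bounceWeight u (α i) (β (i + 1)) = w := by
    rw [← hsum]
    exact Finset.sum_congr rfl fun i _ => (hWγ i).symm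
  refine ⟨q, s, _, hq, ?_, hcod.isLeastEvenPeriod hu hr hit.pos hn hmin hs,
    (hcod.length_eq hu hr hn hs).symm⟩
  obtain ⟨r, -, h, -⟩ := hcod.flight_even hu hr 0
  refine ⟨r, ?_⟩
  rw [frame, Finset.range_zero, Finset.sum_empty, neg_zero, vtx_zero, one_mul, mul_zero,
    zero_add] at h
  rw [h, Complex.real_smul]

theorem exists_cycleWeight_of_flightDirection (hu : ‖u‖ = 1) (ha : 0 ≤ width u 0)
    (hc : 0 < width u 2) (h : IsBilliardTrajectory q s) (hd : flightDirection q 0 = u) {m : ℕ}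
    (hm : IsLeastEvenPeriod q m) : ∃ w ∈ cycleWeights (PentagonStep u),
      ∑ i ∈ Finset.range m, ‖q (i + 1) - q i‖ = closingFactor w * w.1 := by
  obtain ⟨x, α, β, hcod, hr⟩ := exists_coding hu h hd
  obtain ⟨M, rfl⟩ := even_iff_exists_two_mul.1 hm.1.2.1
  have hM : 0 < M := by have := hm.1.1; omega
  have hex : ∃ n, 0 < n ∧ x n = x 0 := ⟨M, hM, ((hcod.periodic_iff hu hr M).1 hm.1.2.2).1⟩
  classical
  set n := Nat.find hex
  obtain ⟨hn, hxn⟩ := Nat.find_spec hex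
  have hmin : ∀ k, 0 < k → k < n → x k ≠ x 0 := fun k hk hkn e => Nat.find_min hex hkn ⟨hk, e⟩
  have hsteps : ∀ i, PentagonStep u (x i) (x (i + 1)) (bounceWeight u (α i) (β (i + 1))) := by
    intro i
    rw [hcod.next]
    exact pentagonStep_of_onSide ha hc (hcod.exit_pos i) (hcod.entry_neg _) (hcod.onExit i)
      (hcod.onMirror i)
  refine ⟨∑ i ∈ Finset.range n, bounceWeight u (α i) (β (i + 1)), ⟨x 0, n, ?_⟩, ?_⟩
  · obtain ⟨k, hk⟩ : ∃ k, n = k + 1 := ⟨n - 1, by omega⟩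
    have := hit_of_sequence hsteps (y := x 0) k 0 (by rw [zero_add, ← hk, hxn]) fun j hj hj' => by
      rw [zero_add]
      exact hmin j hj (by omega)
    simp only [zero_add] at this
    rw [hk]
    exact this
  · rw [hm.unique (hcod.isLeastEvenPeriod hu hr hn hxn hmin rfl)]
    exact hcod.length_eq hu hr hxn rfl

theorem IsLeastEvenPeriod.congr {q q' : ℕ → ℂ} {m : ℕ}
    (h : ∀ N, Function.Periodic q N ↔ Function.Periodic q' N) (hm : IsLeastEvenPeriod q m) :
    IsLeastEvenPeriod q' m := by
  unfold IsLeastEvenPeriod at *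
  simpa only [h] using hm

theorem isLeastEvenPeriod_sideFlip (k : ZMod 5) {m : ℕ} (hm : IsLeastEvenPeriod q m) :
    IsLeastEvenPeriod (fun i => sideFlip k (q i)) m :=
  hm.congr fun _ => ⟨fun h i => congrArg (sideFlip k) (h i),
    fun h i => (sideFlip_involutive k).injective (h i)⟩

theorem isLeastEvenPeriod_shift {m : ℕ} (hm : IsLeastEvenPeriod q m) :
    IsLeastEvenPeriod (fun i => q (i + 1)) m := by
  refine hm.congr fun N => ⟨fun h i => ?_, fun h i => ?_⟩
  · change q (i + N + 1) = q (i + 1)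
    rw [add_right_comm]
    exact h (i + 1)
  · have hp := hm.1.2.2
    obtain ⟨k, hk⟩ : ∃ k, m = k + 1 := ⟨m - 1, by have := hm.1.1; omega⟩
    have := h (i + k)
    simp only at this
    rw [show i + k + N + 1 = i + N + m by omega, show i + k + 1 = i + m by omega, hp, hp] at this
    exact this

theorem norm_sub_sideFlip (k : ZMod 5) (z w : ℂ) :
    ‖sideFlip k z - sideFlip k w‖ = ‖z - w‖ := by
  rw [← sideFlip_sub, norm_sideFlip]

theorem exists_cycleWeight_of_mem (hu : ‖u‖ = 1) (ha : 0 ≤ width u 0) (hc : 0 < width u 2) {l : ℝ}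
    (hl : l ∈ closedTrajectoryLengths u) :
    ∃ w ∈ cycleWeights (PentagonStep u), l = closingFactor w * w.1 := by
  obtain ⟨q, s, m, h', ⟨r, hr⟩, hm, rfl⟩ := mem_closedTrajectoryLengths.1 hl
  rw [Complex.real_smul] at hr
  rcases lt_trichotomy r 0 with hr₀ | hr₀ | hr₀
  -- Starting one bounce later and folding turns `-u` into `u` without changing the period or the
  -- total length.
  · have hd : flightDirection q 0 = -u :=
      flightDirection_eq (r := -r) (by linarith) (by rw [norm_neg, hu])
        (by rw [zero_add, hr]; push_cast; ring)
    have hd' := h'.flightDirection_advance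
    rw [hd, neg_neg] at hd'
    obtain ⟨w, hw, he⟩ := exists_cycleWeight_of_flightDirection hu ha hc h'.advance hd'
      (isLeastEvenPeriod_sideFlip _ (isLeastEvenPeriod_shift hm))
    refine ⟨w, hw, ?_⟩
    rw [← he]
    simp only [norm_sub_sideFlip]
    have hp := hm.1.2.2 0
    have hp1 := hm.1.2.2 1
    rw [zero_add] at hp
    have h1 := Finset.sum_range_succ (fun i => ‖q (i + 1) - q i‖) m
    have h2 := Finset.sum_range_succ' (fun i => ‖q (i + 1) - q i‖) m
    rw [add_comm 1] at hp1
    rw [h1, hp, hp1] at h2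
    exact add_right_cancel h2
  · rw [hr₀, Complex.ofReal_zero, zero_mul, sub_eq_zero] at hr
    exact absurd hr (h'.ne 0)
  · exact exists_cycleWeight_of_flightDirection hu ha hc h'
      (flightDirection_eq hr₀ hu (by rw [zero_add, hr])) hm

theorem closedTrajectoryLengths_subset_sideFlip (k : ZMod 5) (v : ℂ) :
    closedTrajectoryLengths v ⊆ closedTrajectoryLengths (sideFlip k v) := by
  intro l hl
  obtain ⟨q, s, m, h', ⟨r, hr⟩, hm, rfl⟩ := mem_closedTrajectoryLengths.1 hl
  refine ⟨_, _, m, h'.sideFlip k, ⟨r, ?_⟩, isLeastEvenPeriod_sideFlip k hm, ?_⟩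
  · rw [← sideFlip_sub, hr, Complex.real_smul, Complex.real_smul, sideFlip_real_mul]
  · simp only [norm_sub_sideFlip]

theorem closedTrajectoryLengths_vtx_mul (k : ZMod 5) (v : ℂ) :
    closedTrajectoryLengths (vtx k * v) = closedTrajectoryLengths v := by
  have hsub : ∀ k v, closedTrajectoryLengths v ⊆ closedTrajectoryLengths (vtx k * v) := by
    -- Two flips compose to a rotation by twice the difference of their indices, and `2 * 3 = 1`
    -- modulo 5.
    intro k v
    have h := (closedTrajectoryLengths_subset_sideFlip 0 v).trans
      (closedTrajectoryLengths_subset_sideFlip (3 * k) _)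
    rw [sideFlip_sideFlip] at h
    have e : ∀ k : ZMod 5, 2 * (3 * k - 0) = k := by decide
    rwa [e] at h
  refine (hsub k v).antisymm' ?_
  have := hsub (-k) (vtx k * v)
  rwa [← mul_assoc, mul_comm (vtx (-k)), vtx_mul_neg, one_mul] at this

theorem closedTrajectoryLengths_real_mul {r : ℝ} (hr : r ≠ 0) (v : ℂ) :
    closedTrajectoryLengths (r * v) = closedTrajectoryLengths v := by
  have hrc : (r : ℂ) ≠ 0 := by exact_mod_cast hr
  ext l
  constructor
  · rintro ⟨q, s, m, h, ⟨c, hc⟩, hm⟩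
    exact ⟨q, s, m, h, ⟨c * r, by rw [hc, mul_smul, Complex.real_smul (x := r)]⟩, hm⟩
  · rintro ⟨q, s, m, h, ⟨c, hc⟩, hm⟩
    refine ⟨q, s, m, h, ⟨c * r⁻¹, ?_⟩, hm⟩
    rw [hc, mul_smul, ← Complex.real_smul, inv_smul_smul₀ hr]

theorem width_vtx_mul (k t : ZMod 5) (v : ℂ) : width (vtx k * v) t = width v (t - k) := by
  rw [width, width, transv, transv, map_mul, conj_vtx, show t - k + 1 = -k + (t + 1) by ring,
    show t - k = -k + t by ring, vtx_add (-k), vtx_add (-k)]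
  congr 1
  ring

theorem width_real_mul (r : ℝ) (v : ℂ) (t : ZMod 5) : width (r * v) t = r * width v t := by
  rw [width, width, transv, transv, map_mul, Complex.conj_ofReal, mul_assoc,
    Complex.im_ofReal_mul]

/-- By `width_succ` the side between would also have width zero, so two adjacent sides would both be
parallel to `v`. -/
theorem width_two_ne_zero {v : ℂ} (hv : v ≠ 0) {t : ZMod 5} (h : width v t = 0) :
    width v (t + 2) ≠ 0 := by
  intro h2
  have h1 := width_succ v t
  rw [h, h2, add_zero, mul_zero] at h1
  have e : conj v * (vtx (t + 1 + 1) - vtx (t + 1)) =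
      vtx 1 * (conj v * (vtx (t + 1) - vtx t)) := by
    rw [vtx_add (t + 1) 1, vtx_add t 1]
    ring
  rw [width, transv] at h h1
  rw [e, Complex.mul_im, h, mul_zero, zero_add] at h1
  have hre := (mul_eq_zero.1 h1).resolve_left vtx_one_im_pos.ne'
  have h0 : conj v * (vtx (t + 1) - vtx t) = 0 := Complex.ext hre h
  rcases mul_eq_zero.1 h0 with h0 | h0
  · exact hv (by simpa using h0)
  · rw [vtx_add, ← mul_sub_one] at h0
    have := (mul_eq_zero.1 h0).resolve_left (vtx_ne_zero t)
    have := congrArg Complex.im this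
    simp only [Complex.sub_im, Complex.one_im, Complex.zero_im, sub_zero] at this
    exact vtx_one_im_pos.ne' this

/-- Up to the symmetries, every direction lies in the sector between the directions of two sides. -/
theorem exists_sector {v : ℂ} (hv : v ≠ 0) : ∃ (r : ℝ) (k : ZMod 5), r ≠ 0 ∧
    ‖r * (vtx k * v)‖ = 1 ∧ 0 ≤ width (r * (vtx k * v)) 0 ∧ 0 < width (r * (vtx k * v)) 2 := by
  -- Otherwise the sign of the width would change at each step `t ↦ t + 2`, but five such steps, an
  -- odd number, lead back to `t`.
  have key : ∃ t, 0 ≤ width v t ∧ 0 < width v (t + 2) ∨ width v t ≤ 0 ∧ width v (t + 2) < 0 := by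
    by_contra! hcon
    have hne : ∀ t, width v t ≠ 0 := by
      intro t ht
      rcases lt_or_gt_of_ne (width_two_ne_zero hv ht) with h | h
      · exact absurd ((hcon t).2 ht.le) (not_le.2 h)
      · exact absurd ((hcon t).1 ht.ge) (not_le.2 h)
    have hup : ∀ t, 0 < width v t → width v (t + 2) < 0 := fun t ht =>
      lt_of_le_of_ne ((hcon t).1 ht.le) (hne _)
    have hdown : ∀ t, width v t < 0 → 0 < width v (t + 2) := fun t ht =>
      lt_of_le_of_ne ((hcon t).2 ht.le) (hne _).symm
    rcases lt_or_gt_of_ne (hne 0) with h | h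
    · have := hdown _ (hup _ (hdown _ (hup _ (hdown _ h))))
      exact absurd this h.not_gt
    · have := hup _ (hdown _ (hup _ (hdown _ (hup _ h))))
      exact absurd this h.not_gt
  have hnorm : ∀ k, ‖vtx k * v‖ = ‖v‖ := fun k => by rw [norm_mul, norm_vtx, one_mul]
  have hv' : 0 < ‖v‖ := norm_pos_iff.2 hv
  obtain ⟨t, ⟨h0, h2⟩ | ⟨h0, h2⟩⟩ := key
  · refine ⟨‖v‖⁻¹, -t, by positivity, ?_, ?_, ?_⟩
    · rw [norm_mul, hnorm, Complex.norm_real, norm_inv, norm_norm, inv_mul_cancel₀ hv'.ne']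
    · rw [width_real_mul, width_vtx_mul, sub_neg_eq_add, zero_add]
      positivity
    · rw [width_real_mul, width_vtx_mul, sub_neg_eq_add, add_comm]
      positivity
  · have hi : 0 < ‖v‖⁻¹ := by positivity
    refine ⟨-‖v‖⁻¹, -t, (neg_neg_of_pos hi).ne, ?_, ?_, ?_⟩
    · rw [norm_mul, hnorm, Complex.norm_real, norm_neg, norm_inv, norm_norm,
        inv_mul_cancel₀ hv'.ne']
    · rw [width_real_mul, width_vtx_mul, sub_neg_eq_add, zero_add]
      exact mul_nonneg_of_nonpos_of_nonpos (by linarith) h0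
    · rw [width_real_mul, width_vtx_mul, sub_neg_eq_add, add_comm]
      exact mul_pos_of_neg_of_neg (by linarith) h2

/-- Since 3 is a unit modulo 5, both families close up after the same number of turns; otherwise a
factor 5 would enter the ratio of the lengths. -/
theorem closingFactor_goldenPair_mul (w : ℝ × ZMod 5) :
    closingFactor (goldenPair * w) = closingFactor w := by
  have : (3 : ZMod 5) * w.2 = 0 ↔ w.2 = 0 := by
    generalize w.2 = y
    revert y
    decide
  unfold closingFactor
  exact if_congr this rfl rfl

theorem lengths_in_sector (hu : ‖u‖ = 1) (ha : 0 ≤ width u 0) (hc : 0 < width u 2)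
    (h : (closedTrajectoryLengths u).Nonempty) : ∃ l, 0 < l ∧
      closedTrajectoryLengths u = {l, Real.goldenRatio * l} := by
  obtain ⟨l, hl⟩ := h
  obtain ⟨w, ⟨x, n, hw⟩, -⟩ := exists_cycleWeight_of_mem hu ha hc hl
  obtain ⟨w₀, hw₀⟩ := exists_cycleWeights_goldenStep_eq goldenPair_mul_self n _ _ _ _ x w ha hc.le
    (by linarith) hw
  change cycleWeights (PentagonStep u) = _ at hw₀
  have hgold : (closingFactor (goldenPair * w₀) : ℝ) * (goldenPair * w₀).1 =
      Real.goldenRatio * (closingFactor w₀ * w₀.1) := by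
    rw [closingFactor_goldenPair_mul, Prod.fst_mul, goldenPair]
    ring
  have hmem : ∀ w ∈ cycleWeights (PentagonStep u),
      (closingFactor w : ℝ) * w.1 ∈ closedTrajectoryLengths u :=
    fun w hw => length_mem_of_cycleWeight hu ha hc hw
  have h1 := hmem w₀ (by rw [hw₀]; exact .inl rfl)
  have h2 := hmem (goldenPair * w₀) (by rw [hw₀]; exact .inr rfl)
  rw [hgold] at h2
  refine ⟨_, length_pos h1, Set.Subset.antisymm ?_ ?_⟩
  · intro l hl
    obtain ⟨w, hw, rfl⟩ := exists_cycleWeight_of_mem hu ha hc hl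
    rw [hw₀] at hw
    rcases hw with rfl | rfl
    · exact .inl rfl
    · exact .inr hgold
  · rintro l (rfl | rfl)
    · exact h1
    · exact h2

end Lengths

theorem corollary1 (v : ℂ) (hv : IsPeriodicDirection v) :
    ∃ short long : ℝ, 0 < short ∧ closedTrajectoryLengths v = {short, long} ∧
      long / short = Real.goldenRatio := by
  have hv₀ : v ≠ 0 := by
    rintro rfl
    obtain ⟨l, q, s, m, h, ⟨r, hr⟩, -⟩ := hv
    rw [smul_zero, sub_eq_zero] at hr
    exact IsBilliardTrajectory.ne (s := s) h 0 hr
  obtain ⟨r, k, hr, hu, ha, hc⟩ := exists_sector hv₀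
  have he : closedTrajectoryLengths (r * (vtx k * v)) = closedTrajectoryLengths v := by
    rw [closedTrajectoryLengths_real_mul hr, closedTrajectoryLengths_vtx_mul]
  have hne : (closedTrajectoryLengths v).Nonempty := hv
  rw [← he] at hne
  obtain ⟨l, hl, h⟩ := lengths_in_sector hu ha hc hne
  rw [he] at h
  exact ⟨l, Real.goldenRatio * l, hl, h, mul_div_cancel_right₀ _ hl.ne'⟩
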